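/- **Setting.** Consider two-dimensional Minkowski space with points $(t,x)$. A double cone is a set $\mathcal O=\{(t,x): a<t-x<b,\ c<t+x<d\}$ with $a<b$, $c<d$; its spacelike complement $\mathcal O'$ is the disjoint union of a left part $W^{\mathcal O}_{LL}$ and a right part $W^{\mathcal O}_{RR}$. Let $\mathcal O\mapsto\mathcal F(\mathcal O)$ be an inclusion preserving (isotone) map from double cones to von Neumann algebras on a Hilbert space $H$. For a region $S$ let $\mathcal F(S)$ be the norm closed $*$-algebra generated by all $\mathcal F(\mathcal O)$ with $\mathcal O\subset S$, and let $\mathcal F=\mathcal F(\mathbb R^2)$ be the quasilocal algebra. Let $G$ be a group and $\alpha:G\to\mathrm{Aut}\,\mathcal F$ an action by $*$-automorphisms with $\alpha_g(\mathcal F(\mathcal O))=\mathcal F(\mathcal O)$ for all $g$ and $\mathcal O$. For double cones with $\overline{\mathcal O}\subset\hat{\mathcal O}$ write $\Lambda=(\mathcal O,\hat{\mathcal O})$, and let $\mathcal O_1$ (right) and $\mathcal O_2$ (left) be the two double cones which are the connected components of the interior of $\hat{\mathcal O}\cap\mathcal O'$. Assume: 1. (Haag duality) $\mathcal F(\mathcal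 O)=\mathcal F(\mathcal O')'$ for all $\mathcal O$; 2. (split property) for every $\Lambda$ there is a type I factor $M$ with $\mathcal F(\mathcal O)\subset M\subset\mathcal F(\hat{\mathcal O})$; 3. every $\mathcal F(\mathcal O)$ is a factor; 4. (minimal relative commutants) $\mathcal F(\hat{\mathcal O})\cap\mathcal F(\mathcal O)'=\mathcal F(\mathcal O_1)\vee\mathcal F(\mathcal O_2)$ for every $\Lambda$. A *soliton automorphism* for $g\in G$ localized in $\mathcal O$ is a $*$-automorphism $\rho$ of $\mathcal F$ which coincides with $\alpha_g$ on $\mathcal F(W^{\mathcal O}_{LL})$ and with the identity on $\mathcal F(W^{\mathcal O}_{RR})$. It is *locally normal* if its restriction to every local algebra is ultraweakly continuous. A *family of local implementers* consists of a unitary $U^\Lambda_g\in\mathcal F(\hat{\mathcal O})$ for every $\Lambda=(\mathcal O,\hat{\mathcal O})$ and every $g\in G$ such that $\mathrm{Ad}\,U^\Lambda_g=\alpha_g$ on $\mathcal F(\mathcal O)$ and $\mathrm{Ad}\,U^\Lambda_g(\mathcal F(\mathcal O_i))=\mathcal F(\mathcal O_i)$ for $i=1,2$. **Proposition.** (i)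 If there is a family of local implementers with $\alpha_k(U^\Lambda_g)=U^\Lambda_{kgk^{-1}}$ for all $\Lambda$ and all $g,k\in G$, then there are locally normal soliton automorphisms $\rho^{\mathcal O}_g$ (for $g$, localized in $\mathcal O$), for all double cones $\mathcal O$ and all $g\in G$, such that (A) $\alpha_k\circ\rho^{\mathcal O}_g=\rho^{\mathcal O}_{kgk^{-1}}\circ\alpha_k$ for all $\mathcal O$ and all $g,k\in G$. (ii) If there is a family of local implementers with $U^\Lambda_gU^\Lambda_h=U^\Lambda_{gh}$ for all $\Lambda$ and all $g,h\in G$, then there are locally normal soliton automorphisms $\rho^{\mathcal O}_g$, for all $\mathcal O$ and $g$, such that (B) for every $\mathcal O$ the map $g\mapsto\rho^{\mathcal O}_g\in\mathrm{Aut}\,\mathcal F$ is a group homomorphism. (iii) If there is a family of local implementers satisfying both conditions, then there are locally normal soliton automorphisms $\rho^{\mathcal O}_g$, for all $\mathcal O$ and $g$, satisfying both (A) and (B). -/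

import Mathlib

namespace SolitonQFT

universe u v

/-! ### Geometry of two-dimensional Minkowski space -/

/-- Points `(t, x)` of two-dimensional Minkowski space, with time `t = p.1` and space `x = p.2`. -/
abbrev Minkowski : Type := ℝ × ℝ

/-- A double cone in two-dimensional Minkowski space: the nonempty bounded open set
`{(t, x) | a < t - x < b, c < t + x < d}`, given by its light-cone coordinates.
Its left tip is at `(t - x, t + x) = (b, c)` and its right tip at `(a, d)`. -/
@[ext]
structure DoubleCone where
  a : ℝ
  b : ℝ
  c : ℝ
  d : ℝ
  hab : a < b
  hcd : c < d

namespace DoubleCone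

/-- The set of points of a double cone. -/
def carrier (O : DoubleCone) : Set Minkowski :=
  {p | O.a < p.1 - p.2 ∧ p.1 - p.2 < O.b ∧ O.c < p.1 + p.2 ∧ p.1 + p.2 < O.d}

/-- The spacelike complement `O'`: all points spacelike separated from every point of `O`. -/
def spacelikeComplement (O : DoubleCone) : Set Minkowski :=
  {p | ∀ q ∈ O.carrier, |p.1 - q.1| < |p.2 - q.2|}

/-- The left spacelike complement of `O`: all points which are spacelike separated from, and to
the left of, every point of `O`. -/
def leftComplement (O : DoubleCone) : Set Minkowski :=
  {p | ∀ q ∈ O.carrier, |p.1 - q.1| < q.2 - p.2}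

/-- The right spacelike complement of `O`: all points which are spacelike separated from, and to
the right of, every point of `O`. -/
def rightComplement (O : DoubleCone) : Set Minkowski :=
  {p | ∀ q ∈ O.carrier, |p.1 - q.1| < p.2 - q.2}

end DoubleCone

/-- A pair `Λ = (O, Ô)` of double cones such that the closure of `O = Λ.inner` is contained in
`Ô = Λ.outer`; in light-cone coordinates this means four strict inequalities. -/
structure ConePair where
  inner : DoubleCone
  outer : DoubleCone
  ha : outer.a < inner.a
  hb : inner.b < outer.b
  hc : outer.c < inner.c
  hd : inner.d < outer.d

namespace ConePair

/-- The double cone which is the right one of the two connected components of the (interior of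
the) intersection of `Ô` with the spacelike complement of `O`. It touches `O` in its right tip. -/
def right (Λ : ConePair) : DoubleCone where
  a := Λ.outer.a
  b := Λ.inner.a
  c := Λ.inner.d
  d := Λ.outer.d
  hab := Λ.ha
  hcd := Λ.hd

/-- The double cone which is the left one of the two connected components of the (interior of
the) intersection of `Ô` with the spacelike complement of `O`. It touches `O` in its left tip. -/
def left (Λ : ConePair) : DoubleCone where
  a := Λ.inner.b
  b := Λ.outer.b
  c := Λ.outer.c
  d := Λ.inner.c
  hab := Λ.hb
  hcd := Λ.hc

end ConePair

/-! ### Nets of von Neumann algebras -/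

/-- An inclusion preserving assignment of von Neumann algebras on a Hilbert space `H` to the
double cones. -/
structure LocalNet (H : Type u) [NormedAddCommGroup H] [InnerProductSpace ℂ H]
    [CompleteSpace H] where
  /-- The local algebra `F(O)`. -/
  alg : DoubleCone → VonNeumannAlgebra H
  isotone : ∀ O₁ O₂ : DoubleCone, O₁.carrier ⊆ O₂.carrier → alg O₁ ≤ alg O₂

section

variable {H : Type u} [NormedAddCommGroup H] [InnerProductSpace ℂ H] [CompleteSpace H]

/-- A von Neumann algebra is a factor if its center consists of the multiples of `1`. -/
def IsFactor (M : VonNeumannAlgebra H) : Prop :=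
  ∀ x ∈ M, x ∈ M.commutant → ∃ z : ℂ, x = z • (1 : H →L[ℂ] H)

/-- A type I factor: a factor that is `*`-isomorphic to the algebra of all bounded operators
on some Hilbert space. -/
def IsTypeIFactor (M : VonNeumannAlgebra H) : Prop :=
  IsFactor M ∧
    ∃ (K : Type u) (_ : NormedAddCommGroup K) (_ : InnerProductSpace ℂ K) (_ : CompleteSpace K),
      Nonempty (M.toStarSubalgebra ≃⋆ₐ[ℂ] (K →L[ℂ] K))

namespace LocalNet

/-- The `C*`-algebra `F(S)` of a region `S`: the norm closed `*`-algebra generated by the local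
algebras of all double cones contained in `S`. -/
noncomputable def region (F : LocalNet H) (S : Set Minkowski) : StarSubalgebra ℂ (H →L[ℂ] H) :=
  (⨆ (O : DoubleCone) (_ : O.carrier ⊆ S), (F.alg O).toStarSubalgebra).topologicalClosure

/-- The quasilocal algebra: the norm closure of the (directed) union of all local algebras. -/
noncomputable abbrev quasilocal (F : LocalNet H) : StarSubalgebra ℂ (H →L[ℂ] H) :=
  F.region Set.univ

/-- Haag duality `F(O) = F(O')'`. In particular, spacelike separated local algebras commute. -/
def HaagDuality (F : LocalNet H) : Prop :=
  ∀ O : DoubleCone, (F.alg O : Set (H →L[ℂ] H)) =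
    Set.centralizer (F.region O.spacelikeComplement : Set (H →L[ℂ] H))

/-- The split property for double cones. -/
def SplitProperty (F : LocalNet H) : Prop :=
  ∀ Λ : ConePair, ∃ M : VonNeumannAlgebra H,
    IsTypeIFactor M ∧ F.alg Λ.inner ≤ M ∧ M ≤ F.alg Λ.outer

/-- All local algebras are factors. -/
def LocalFactors (F : LocalNet H) : Prop :=
  ∀ O : DoubleCone, IsFactor (F.alg O)

/-- Minimality of relative commutants: `F(Ô) ∧ F(O)' = F(O₁) ∨ F(O₂)`, where the von Neumann
algebra generated by two von Neumann algebras is the double commutant of their union. -/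
def MinimalRelativeCommutants (F : LocalNet H) : Prop :=
  ∀ Λ : ConePair,
    (F.alg Λ.outer : Set (H →L[ℂ] H)) ∩ Set.centralizer (F.alg Λ.inner : Set (H →L[ℂ] H)) =
      Set.centralizer (Set.centralizer
        ((F.alg Λ.right : Set (H →L[ℂ] H)) ∪ (F.alg Λ.left : Set (H →L[ℂ] H))))

/-- The group of `*`-automorphisms of the quasilocal algebra. -/
abbrev Aut (F : LocalNet H) : Type u := F.quasilocal ≃⋆ₐ[ℂ] F.quasilocal

/-- An action of a group `G` on the quasilocal algebra by internal symmetries, that is, by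
automorphisms which map every local algebra onto itself. -/
structure Symmetry (F : LocalNet H) (G : Type v) [Group G] where
  /-- The automorphisms `α_g`. -/
  toHom : G →* F.Aut
  map_alg : ∀ (g : G) (O : DoubleCone) (A : F.quasilocal),
    (toHom g A : H →L[ℂ] H) ∈ F.alg O ↔ (A : H →L[ℂ] H) ∈ F.alg O

/-- An automorphism `ρ` of the quasilocal algebra is locally normal if its restriction to each
local algebra is normal, i.e. ultraweakly continuous. The ultraweakly continuous functionals are
`A ↦ ∑ ⟪xₙ, A yₙ⟫` with `∑ ‖xₙ‖² < ∞` and `∑ ‖yₙ‖² < ∞`, and their compositions with `ρ` are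
required to be of the same form on each local algebra. -/
def LocallyNormal (F : LocalNet H) (ρ : F.Aut) : Prop :=
  ∀ O : DoubleCone, ∀ x y : ℕ → H,
    Summable (fun n => ‖x n‖ ^ 2) → Summable (fun n => ‖y n‖ ^ 2) →
    ∃ x' y' : ℕ → H,
      Summable (fun n => ‖x' n‖ ^ 2) ∧ Summable (fun n => ‖y' n‖ ^ 2) ∧
      ∀ A : F.quasilocal, (A : H →L[ℂ] H) ∈ F.alg O →
        ∑' n, inner ℂ (x n) ((ρ A : H →L[ℂ] H) (y n)) =
          ∑' n, inner ℂ (x' n) ((A : H →L[ℂ] H) (y' n))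

/-- A (left) soliton automorphism for the group element `g`, localized in the double cone `O`:
it acts as `α_g` on the left spacelike complement of `O` and trivially on the right one. -/
structure IsSoliton (F : LocalNet H) {G : Type v} [Group G] (α : F.Symmetry G)
    (g : G) (O : DoubleCone) (ρ : F.Aut) : Prop where
  left : ∀ A : F.quasilocal, (A : H →L[ℂ] H) ∈ F.region O.leftComplement → ρ A = α.toHom g A
  right : ∀ A : F.quasilocal, (A : H →L[ℂ] H) ∈ F.region O.rightComplement → ρ A = A

/-- A unitary `U ∈ F(Ô)` which implements `α_g` on `F(O)` and whose adjoint action restricts to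
automorphisms of `F(O₁)` and of `F(O₂)` separately. -/
structure IsLocalImplementer (F : LocalNet H) {G : Type v} [Group G] (α : F.Symmetry G)
    (g : G) (Λ : ConePair) (U : F.quasilocal) : Prop where
  mem : (U : H →L[ℂ] H) ∈ F.alg Λ.outer
  unitary : U ∈ unitary F.quasilocal
  implements : ∀ A : F.quasilocal, (A : H →L[ℂ] H) ∈ F.alg Λ.inner →
    U * A * star U = α.toHom g A
  right : (fun A : H →L[ℂ] H => (U : H →L[ℂ] H) * A * star (U : H →L[ℂ] H)) ''
    (F.alg Λ.right : Set (H →L[ℂ] H)) = F.alg Λ.right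
  left : (fun A : H →L[ℂ] H => (U : H →L[ℂ] H) * A * star (U : H →L[ℂ] H)) ''
    (F.alg Λ.left : Set (H →L[ℂ] H)) = F.alg Λ.left

/-- A family of local implementers `U^Λ_g`, one for every `Λ = (O, Ô)` and every `g`. -/
def IsImplementerFamily (F : LocalNet H) {G : Type v} [Group G] (α : F.Symmetry G)
    (U : ConePair → G → F.quasilocal) : Prop :=
  ∀ Λ g, F.IsLocalImplementer α g Λ (U Λ g)

/-- The covariance condition `α_k(U^Λ_g) = U^Λ_{kgk⁻¹}`. -/
def CovariantImplementers (F : LocalNet H) {G : Type v} [Group G] (α : F.Symmetry G)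
    (U : ConePair → G → F.quasilocal) : Prop :=
  ∀ Λ k g, α.toHom k (U Λ g) = U Λ (k * g * k⁻¹)

/-- The homomorphism condition `U^Λ_g U^Λ_h = U^Λ_{gh}`. -/
def MultiplicativeImplementers (F : LocalNet H) {G : Type v} [Group G]
    (U : ConePair → G → F.quasilocal) : Prop :=
  ∀ Λ g h, U Λ g * U Λ h = U Λ (g * h)

/-- A family of locally normal (left) soliton automorphisms `ρ^O_g`, one for every double cone
`O` and every `g`. -/
def IsSolitonFamily (F : LocalNet H) {G : Type v} [Group G] (α : F.Symmetry G)
    (ρ : DoubleCone → G → F.Aut) : Prop :=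
  ∀ O g, F.IsSoliton α g O (ρ O g) ∧ F.LocallyNormal (ρ O g)

/-- Property (A): `α_k ∘ ρ^O_g = ρ^O_{kgk⁻¹} ∘ α_k`. -/
def PropertyA (F : LocalNet H) {G : Type v} [Group G] (α : F.Symmetry G)
    (ρ : DoubleCone → G → F.Aut) : Prop :=
  ∀ O k g, α.toHom k * ρ O g = ρ O (k * g * k⁻¹) * α.toHom k

/-- Property (B): for every double cone `O`, `g ↦ ρ^O_g` is a group homomorphism. -/
def PropertyB (F : LocalNet H) {G : Type v} [Group G]
    (ρ : DoubleCone → G → F.Aut) : Prop :=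
  ∀ O g h, ρ O (g * h) = ρ O g * ρ O h

end LocalNet

end

end SolitonQFT

/-! Let `D` be the localization region and choose a pair Λ whose right relative complement is `D`.
The implementer U for Λ acts as α_g on the inner cone, which touches the left tip of `D`; it maps
F(D) onto itself and commutes with everything to the right of `D`. So ρ should be α_g to the left of
that tip and Ad U to the right of it, and the task is to glue these two actions.

On a large cone K, the implementer V for K and a slightly larger cone realizes α_g. Then V*U
commutes with the inner algebra, so by minimality of relative commutants it lies in the von Neumann
algebra generated by F(N) and F(P), where N and P are the cones to the left and right of the inner
one. U and V both normalize F(N), and N and P are split, so Ad(V*U) is inner on the factor F(N), say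
Ad w (`exists_unitary_implementing`). The unitary Uw* then does what is wanted on K
(`exists_unitary_glueing`).

A local algebra is generated by the algebras of the two parts of a cut cone
(`mem_commutant_of_isCut`). Hence the actions for growing K are compatible, and ρ is their norm
limit. The same uniqueness yields (A) and (B): both sides are unitarily implemented on local
algebras, so it suffices to compare them on the left, where α is a homomorphism, and on the right,
where the hypothesis on U applies.

The operator-algebraic inputs concern algebras generated by N ⊆ M and P ⊆ M' with M a type I factor.
There M and M' behave like tensor factors, and slice maps give the proofs. -/

namespace SolitonQFT

open InnerProductSpace

open scoped CStarAlgebra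

universe u v

/-! ### Type I factors -/

section TypeI

universe w

variable {H : Type w} [NormedAddCommGroup H] [InnerProductSpace ℂ H] [CompleteSpace H]

/-- A faithful `*`-representation of the bounded operators on `K` with range the von Neumann
algebra `M`, together with a unit vector of `K`. -/
structure TypeIData (M : VonNeumannAlgebra H) (K : Type w) [NormedAddCommGroup K]
    [InnerProductSpace ℂ K] [CompleteSpace K] where
  rep : (K →L[ℂ] K) →⋆ₐ[ℂ] (H →L[ℂ] H)
  rep_mem : ∀ k, rep k ∈ M
  exists_rep_eq : ∀ m ∈ M, ∃ k, rep k = m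
  rep_injective : Function.Injective rep
  vec : K
  norm_vec : ‖vec‖ = 1

theorem IsTypeIFactor.exists_typeIData [Nontrivial H] {M : VonNeumannAlgebra H}
    (hM : IsTypeIFactor M) :
    ∃ (K : Type w) (_ : NormedAddCommGroup K) (_ : InnerProductSpace ℂ K) (_ : CompleteSpace K),
      Nonempty (TypeIData M K) := by
  obtain ⟨-, K, i1, i2, i3, ⟨φ⟩⟩ := hM
  refine ⟨K, i1, i2, i3, ?_⟩
  have hK : Nontrivial K := by
    by_contra hK
    rw [not_nontrivial_iff_subsingleton] at hK
    have h1 : φ.symm 1 = φ.symm 0 := congrArg _ (Subsingleton.elim _ _)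
    rw [map_one, map_zero] at h1
    exact one_ne_zero (congrArg Subtype.val h1 : (1 : H →L[ℂ] H) = 0)
  obtain ⟨ξ, hξ⟩ := exists_norm_eq K (zero_le_one (α := ℝ))
  refine ⟨{
    rep := M.toStarSubalgebra.subtype.comp (φ.symm : (K →L[ℂ] K) →⋆ₐ[ℂ] M.toStarSubalgebra)
    rep_mem := fun k => (φ.symm k).2
    exists_rep_eq := fun m hm => ⟨φ ⟨m, hm⟩, by simp⟩
    rep_injective := Subtype.val_injective.comp φ.symm.injective
    vec := ξ
    norm_vec := hξ }⟩

namespace TypeIData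

variable {M : VonNeumannAlgebra H} {K : Type w} [NormedAddCommGroup K]
    [InnerProductSpace ℂ K] [CompleteSpace K] (D : TypeIData M K)

/-- The operator in `M` representing the rank one operator `ζ ↦ ⟪vec, ζ⟫ • η`. -/
noncomputable def col (η : K) : H →L[ℂ] H := D.rep (rankOne ℂ η D.vec)

/-- The minimal projection of `M` given by the distinguished unit vector. -/
noncomputable def proj : H →L[ℂ] H := D.col D.vec

theorem col_mem (η : K) : D.col η ∈ M := D.rep_mem _

theorem inner_vec_vec : inner ℂ D.vec D.vec = (1 : ℂ) := by
  rw [inner_self_eq_norm_sq_to_K, D.norm_vec]; simp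

theorem rep_mul_col (k : K →L[ℂ] K) (η : K) : D.rep k * D.col η = D.col (k η) := by
  rw [col, col, ← map_mul, ContinuousLinearMap.mul_def, comp_rankOne]

theorem star_col_mul_col (η ζ : K) : star (D.col η) * D.col ζ = inner ℂ η ζ • D.proj := by
  rw [proj, col, col, col, ← map_star, ← map_mul, ← map_smul]
  congr 1
  rw [ContinuousLinearMap.star_eq_adjoint, adjoint_rankOne, ContinuousLinearMap.mul_def,
    rankOne_comp_rankOne]

theorem star_proj : star D.proj = D.proj := by
  rw [proj, col, ← map_star, ContinuousLinearMap.star_eq_adjoint, adjoint_rankOne]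

theorem col_mul_proj (η : K) : D.col η * D.proj = D.col η := by
  rw [proj, col, D.rep_mul_col, rankOne_apply, inner_vec_vec, one_smul, ← col]

theorem proj_mul_star_col (η : K) : D.proj * star (D.col η) = star (D.col η) := by
  rw [← D.star_proj, ← star_mul, D.col_mul_proj]

theorem proj_ne_zero : D.proj ≠ 0 := by
  intro h
  have h0 : rankOne ℂ D.vec D.vec = 0 := D.rep_injective (by rw [map_zero]; exact h)
  have := congrArg (fun f : K →L[ℂ] K => f D.vec) h0
  simp only [rankOne_apply, inner_vec_vec, one_smul, zero_apply] at this
  simpa [this] using D.norm_vec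

theorem col_add (η ζ : K) : D.col (η + ζ) = D.col η + D.col ζ := by simp [col]

theorem col_smul (c : ℂ) (η : K) : D.col (c • η) = c • D.col η := by simp [col]

theorem continuous_col : Continuous D.col := by
  have : Continuous D.rep := map_continuous D.rep
  unfold col
  fun_prop

/-- The intertwiner `K → H`, `η ↦ col η h`. -/
noncomputable def intertwiner (h : H) : K →L[ℂ] H where
  toFun η := D.col η h
  map_add' η ζ := by simp [col_add]
  map_smul' c η := by simp [col_smul]
  cont := D.continuous_col.clm_apply continuous_const

@[simp] theorem intertwiner_apply (h : H) (η : K) : D.intertwiner h η = D.col η h := rfl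

theorem comp_intertwiner (k : K →L[ℂ] K) (h : H) :
    (D.rep k) ∘L D.intertwiner h = D.intertwiner h ∘L k := by
  ext η
  simp [← D.rep_mul_col]

/-- The isomorphism with the bounded operators on `K` is not assumed normal, so factoriality must
show that the columns reach all of `H`. The common kernel is invariant under `M` and under its
commutant, so its projection is central, hence a scalar. It is not 1, since `proj` would then
vanish. -/
theorem eq_zero_of_star_col (hM : IsFactor M) (v : H) (hv : ∀ η, star (D.col η) v = 0) :
    v = 0 := by
  let N : Submodule ℂ H := ⨅ η, (star (D.col η)).ker
  have hN : ∀ x, x ∈ N ↔ ∀ η, star (D.col η) x = 0 := by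
    intro x; simp [N, Submodule.mem_iInf]
  have hc : IsClosed (N : Set H) := by
    have : (N : Set H) = ⋂ η, ((star (D.col η)).ker : Set H) := by simp [N]
    rw [this]
    exact isClosed_iInter fun η => (star (D.col η)).isClosed_ker
  have : CompleteSpace N := hc.completeSpace_coe
  have hq : IsStarProjection N.starProjection := isStarProjection_starProjection
  have hr : N.starProjection.range = N := by simp
  have h1 : N.starProjection ∈ M := by
    rw [VonNeumannAlgebra.IsStarProjection.mem_iff hq]
    intro y hy
    rw [hr]
    intro x hx
    have hx' := (hN x).1 hx
    refine (hN _).2 fun η => ?_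
    have := VonNeumannAlgebra.mem_commutant_iff.1 hy _ (star_mem (D.col_mem η))
    have := congrArg (fun f : H →L[ℂ] H => f x) this
    simpa [hx'] using this
  have h2 : N.starProjection ∈ M.commutant := by
    rw [VonNeumannAlgebra.IsStarProjection.mem_iff hq]
    intro y hy
    rw [VonNeumannAlgebra.commutant_commutant] at hy
    rw [hr]
    intro x hx
    have hx' := (hN x).1 hx
    refine (hN _).2 fun η => ?_
    obtain ⟨k, hk⟩ := D.exists_rep_eq _ (star_mem hy)
    have h3 : star (D.col η) * y = star (D.col (k η)) := by
      rw [← D.rep_mul_col, hk, star_mul, star_star]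
    have := congrArg (fun f : H →L[ℂ] H => f x) h3
    simpa [hx'] using this
  obtain ⟨z, hz⟩ := hM _ h1 h2
  by_contra hv0
  have hvN : N.starProjection v = v := Submodule.starProjection_eq_self_iff.2 ((hN v).2 hv)
  have hz1 : z = 1 := by
    rw [hz] at hvN
    have : (z - 1) • v = 0 := by
      rw [sub_smul, one_smul]; simpa [sub_eq_zero] using hvN
    rcases smul_eq_zero.1 this with h | h
    · exact sub_eq_zero.1 h
    · exact absurd h hv0
  apply D.proj_ne_zero
  rw [← D.star_proj]
  ext x
  have hx : x ∈ N := by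
    rw [← Submodule.starProjection_eq_self_iff, hz, hz1]; simp
  exact (hN x).1 hx _

theorem ext_of_mul_col (hM : IsFactor M) {S T : H →L[ℂ] H}
    (h : ∀ ζ, S * D.col ζ = T * D.col ζ) : S = T := by
  have h2 : star (S - T) = 0 := by
    ext x
    refine D.eq_zero_of_star_col hM _ fun η => ?_
    have : star (D.col η) * star (S - T) = 0 := by
      rw [← star_mul, sub_mul, h, sub_self, star_zero]
    simpa using congrArg (fun f : H →L[ℂ] H => f x) this
  exact sub_eq_zero.1 (by simpa using congrArg star h2)

theorem ext_of_star_col (hM : IsFactor M) {S T : H →L[ℂ] H}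
    (h : ∀ η ζ, star (D.col η) * S * D.col ζ = star (D.col η) * T * D.col ζ) : S = T := by
  refine D.ext_of_mul_col hM fun ζ => ?_
  ext x
  rw [← sub_eq_zero]
  refine D.eq_zero_of_star_col hM _ fun η => ?_
  have := congrArg (fun f : H →L[ℂ] H => f x) (h η ζ)
  simpa [sub_eq_zero] using this

/-- The operator on `K` with matrix elements `⟪col η h, T (col ζ k)⟫`. -/
noncomputable def slice (h k : H) (T : H →L[ℂ] H) : K →L[ℂ] K :=
  (D.intertwiner h).adjoint ∘L T ∘L D.intertwiner k

theorem inner_slice (h k : H) (T : H →L[ℂ] H) (η ζ : K) :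
    inner ℂ η (D.slice h k T ζ) = inner ℂ (D.col η h) (T (D.col ζ k)) := by
  simp [slice, ContinuousLinearMap.adjoint_inner_right]

theorem ext_of_slice (hM : IsFactor M) {S T : H →L[ℂ] H}
    (hST : ∀ h k, D.slice h k S = D.slice h k T) : S = T := by
  refine D.ext_of_star_col hM fun η ζ => ?_
  ext k
  refine ext_inner_left ℂ fun h => ?_
  have := congrArg (fun f => inner ℂ η (f ζ)) (hST h k)
  simp only [inner_slice] at this
  simpa [ContinuousLinearMap.star_eq_adjoint, ContinuousLinearMap.adjoint_inner_right] using this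

/-- In the picture H = K ⊗ K' the slices are the maps id ⊗ ω with ω a vector functional; like those,
they are bimodule maps over the bounded operators on `K`. -/
theorem slice_mul_rep (h k : H) (T : H →L[ℂ] H) (a : K →L[ℂ] K) :
    D.slice h k (T * D.rep a) = D.slice h k T * a := by
  simp only [slice, ContinuousLinearMap.mul_def, ContinuousLinearMap.comp_assoc, comp_intertwiner]

theorem slice_rep_mul (h k : H) (T : H →L[ℂ] H) (a : K →L[ℂ] K) :
    D.slice h k (D.rep a * T) = a * D.slice h k T := by
  have : (D.intertwiner h).adjoint ∘L D.rep a = a ∘L (D.intertwiner h).adjoint := by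
    have := congrArg ContinuousLinearMap.adjoint (D.comp_intertwiner a.adjoint h)
    simpa [ContinuousLinearMap.adjoint_comp, ← ContinuousLinearMap.star_eq_adjoint, map_star]
      using this
  simp only [slice, ContinuousLinearMap.mul_def, ← ContinuousLinearMap.comp_assoc, this]

/-- A slice of an element x of N' again commutes with `N`, by the bimodule property, and with `P`,
because it lies in `M`. So `T` commutes with it, and slicing this relation shows that the slices of
`T` commute with those of x. The slices of x being arbitrary, the slices of `T` commute with x
itself. -/
theorem rep_slice_mem (hM : IsFactor M) {N P : VonNeumannAlgebra H} (hN : N ≤ M)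
    (hP : P ≤ M.commutant) {T : H →L[ℂ] H}
    (hT : T ∈ Set.centralizer (Set.centralizer ((N : Set (H →L[ℂ] H)) ∪ P))) (h k : H) :
    D.rep (D.slice h k T) ∈ N := by
  rw [← VonNeumannAlgebra.commutant_commutant N, VonNeumannAlgebra.mem_commutant_iff]
  intro x hx
  rw [VonNeumannAlgebra.mem_commutant_iff] at hx
  refine D.ext_of_slice hM fun a b => ?_
  rw [slice_mul_rep, slice_rep_mul]
  have hy : D.rep (D.slice a b x) ∈ Set.centralizer ((N : Set (H →L[ℂ] H)) ∪ P) := by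
    rintro n (hn | hn)
    · obtain ⟨ν, hν⟩ := D.exists_rep_eq n (hN hn)
      rw [← hν, ← map_mul, ← map_mul, ← slice_rep_mul, ← slice_mul_rep, hν, hx n hn]
    · exact ((VonNeumannAlgebra.mem_commutant_iff.1 (hP hn)) _ (D.rep_mem _)).symm
  simpa only [slice_rep_mul, slice_mul_rep] using congrArg (D.slice h k) (hT _ hy)

/-- The operator is 1 ⊗ T, realized as the strong sum of `col (b i) * T * star (col (b i))` over an
orthonormal basis b of `K`. The summands have orthogonal ranges, and Bessel's inequality bounds the
sum by ‖T‖. -/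
theorem exists_amplification {T : H →L[ℂ] H} (hT : D.proj * T = T)
    (hTp : T * D.proj = T) :
    ∃ x : H →L[ℂ] H, ∀ ζ, x * D.col ζ = D.col ζ * T := by
  obtain ⟨s, b, hb⟩ := exists_hilbertBasis ℂ K
  classical
  have horth : ∀ i j, inner ℂ (b i) (b j) = if i = j then (1 : ℂ) else 0 := 
    orthonormal_iff_ite.1 b.orthonormal
  have hinner : ∀ (i j) (v w : H), inner ℂ (D.col (b i) v) (D.col (b j) w) =
      if i = j then inner ℂ v (D.proj w) else 0 := by
    intro i j v w
    rw [← ContinuousLinearMap.adjoint_inner_right, ← ContinuousLinearMap.star_eq_adjoint,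
      ← mul_apply_eq_comp, star_col_mul_col, horth]
    split_ifs <;> simp
  have hpp : D.proj * D.proj = D.proj := D.col_mul_proj _
  let G : Submodule ℂ H := D.proj.range
  have hG : ∀ v : G, D.proj v = v := by
    rintro ⟨_, v, rfl⟩
    exact congrArg (fun f : H →L[ℂ] H => f v) hpp
  let V : s → G →ₗᵢ[ℂ] H := fun i =>
    { toLinearMap := (D.col (b i)).toLinearMap ∘ₗ G.subtype
      norm_map' := fun v => by
        rw [← sq_eq_sq₀ (norm_nonneg _) (norm_nonneg _)]
        have := hinner i i v v
        simp only [if_true, hG v] at this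
        rw [inner_self_eq_norm_sq_to_K, inner_self_eq_norm_sq_to_K] at this
        exact_mod_cast this }
  have hV : OrthogonalFamily ℂ (fun _ : s => G) V := by
    intro i j hij v w
    exact (hinner i j v w).trans (if_neg hij)
  have hstar : ∀ i (v : H), star (D.col (b i)) v ∈ G := fun i v =>
    ⟨star (D.col (b i)) v, congrArg (fun f : H →L[ℂ] H => f v) (D.proj_mul_star_col (b i))⟩
  let c : s → H →ₗ[ℂ] G := fun i =>
    (star (D.col (b i))).toLinearMap.codRestrict G (hstar i)
  have hVc : ∀ i v, V i (c i v) = D.col (b i) (star (D.col (b i)) v) := fun i v => rfl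
  have hbessel : ∀ (t : Finset s) (v : H), ∑ i ∈ t, ‖c i v‖ ^ 2 ≤ ‖v‖ ^ 2 := by
    intro t v
    have h1 := hV.norm_sum (fun i => c i v) t
    set u := ∑ i ∈ t, V i (c i v) with hu
    have h2 : inner ℂ v u = ((∑ i ∈ t, ‖c i v‖ ^ 2 : ℝ) : ℂ) := by
      rw [hu, inner_sum]
      push_cast
      refine Finset.sum_congr rfl fun i _ => ?_
      rw [hVc, ← ContinuousLinearMap.adjoint_inner_left, ← ContinuousLinearMap.star_eq_adjoint,
        inner_self_eq_norm_sq_to_K]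
      rfl
    have h3 := norm_inner_le_norm (𝕜 := ℂ) v u
    rw [h2, ← h1] at h3
    simp only [Complex.ofReal_pow, norm_pow, Complex.norm_real, norm_norm] at h3
    rw [← h1]
    rcases (norm_nonneg u).eq_or_lt with h0 | h0
    · rw [← h0, zero_pow two_ne_zero]; positivity
    · have : ‖u‖ ≤ ‖v‖ := by nlinarith
      gcongr
  have hTG : ∀ v, T v ∈ G := fun v => ⟨T v, congrArg (fun f : H →L[ℂ] H => f v) hT⟩
  let T' : H →ₗ[ℂ] G := T.toLinearMap.codRestrict G hTG
  have hT' : ∀ v, ‖T' v‖ ≤ ‖T‖ * ‖v‖ := fun v => T.le_opNorm v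
  let f : s → H →ₗ[ℂ] G := fun i => T' ∘ₗ G.subtype ∘ₗ c i
  have hf : ∀ i v, ‖f i v‖ ^ 2 ≤ ‖T‖ ^ 2 * ‖c i v‖ ^ 2 := by
    intro i v
    rw [← mul_pow]
    gcongr
    exact hT' _
  have hfsum : ∀ (t : Finset s) (v : H), ∑ i ∈ t, ‖f i v‖ ^ 2 ≤ ‖T‖ ^ 2 * ‖v‖ ^ 2 := by
    intro t v
    calc ∑ i ∈ t, ‖f i v‖ ^ 2 ≤ ∑ i ∈ t, ‖T‖ ^ 2 * ‖c i v‖ ^ 2 :=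
          Finset.sum_le_sum fun i _ => hf i v
      _ ≤ _ := by rw [← Finset.mul_sum]; gcongr; exact hbessel t v
  have hsummable : ∀ v, Summable fun i => V i (f i v) := by
    intro v
    rw [hV.summable_iff_norm_sq_summable]
    exact summable_of_sum_le (fun i => by positivity) (fun t => hfsum t v)
  let x : H →L[ℂ] H := LinearMap.mkContinuous
    { toFun := fun v => ∑' i, V i (f i v)
      map_add' := fun v w => by
        simp only [map_add]
        exact (hsummable v).tsum_add (hsummable w)
      map_smul' := fun a v => by
        simp only [map_smul, RingHom.id_apply]
        exact (hsummable v).tsum_const_smul a } ‖T‖ (by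
      intro v
      refine le_of_tendsto ((hsummable v).hasSum.norm) (Filter.Eventually.of_forall fun t => ?_)
      rw [← sq_le_sq₀ (norm_nonneg _) (by positivity), hV.norm_sum (fun i => f i v) t, mul_pow]
      exact hfsum t v)
  refine ⟨x, fun ζ => ?_⟩
  ext v
  have hx : HasSum (fun i => V i (f i (D.col ζ v))) (x (D.col ζ v)) := (hsummable _).hasSum
  refine hx.unique ?_
  have hterm : ∀ i, V i (f i (D.col ζ v)) = (D.col (b.repr ζ i • b i)) (T v) := by
    intro i
    have h1 : star (D.col (b i)) (D.col ζ v) = inner ℂ (b i) ζ • D.proj v := by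
      rw [← mul_apply_eq_comp, star_col_mul_col]; rfl
    change D.col (b i) (T (star (D.col (b i)) (D.col ζ v))) = _
    rw [h1, b.repr_apply_apply, D.col_smul, map_smul, map_smul, ← mul_apply_eq_comp T, hTp]
    rfl
  simp only [hterm]
  exact (D.intertwiner (T v)).hasSum (b.hasSum_repr ζ)

end TypeIData

/-- An element commuting with `N` and lying in the von Neumann algebra generated by the commuting
algebras `N ⊆ M` and `P ⊆ M'` belongs to `P` if `N` is a factor. -/
theorem mem_of_mem_generated_of_mem_commutant {M : VonNeumannAlgebra H} (hMI : IsTypeIFactor M) {N P : VonNeumannAlgebra H}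
    (hNf : IsFactor N) (hN : N ≤ M) (hP : P ≤ M.commutant) {z : H →L[ℂ] H}
    (hz : z ∈ Set.centralizer (Set.centralizer ((N : Set (H →L[ℂ] H)) ∪ P)))
    (hzN : z ∈ N.commutant) : z ∈ P := by
  rcases subsingleton_or_nontrivial H with hH | hH
  · rw [Subsingleton.elim z 0]; exact zero_mem P
  obtain ⟨K, _, _, _, ⟨D⟩⟩ := hMI.exists_typeIData
  have hM := hMI.1
  rw [VonNeumannAlgebra.mem_commutant_iff] at hzN
  -- The slices of `z` lie in `N` and commute with `N`, so they are scalars: `z` has the form 1 ⊗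
  -- z'. Hence it commutes with `M`.
  have hscalar : ∀ h k, ∃ c : ℂ, D.slice h k z = c • 1 := by
    intro h k
    obtain ⟨c, hc⟩ := hNf (D.rep (D.slice h k z)) (D.rep_slice_mem hM hN hP hz h k) (by
      rw [VonNeumannAlgebra.mem_commutant_iff]
      intro n hn
      obtain ⟨ν, hν⟩ := D.exists_rep_eq n (hN hn)
      rw [← hν, ← map_mul, ← map_mul, ← D.slice_rep_mul, ← D.slice_mul_rep, hν, hzN n hn])
    exact ⟨c, D.rep_injective (by rw [hc, map_smul, map_one])⟩
  have hzM : ∀ m ∈ M, m * z = z * m := by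
    intro m hm
    obtain ⟨k, rfl⟩ := D.exists_rep_eq m hm
    refine D.ext_of_slice hM fun a b => ?_
    obtain ⟨c, hc⟩ := hscalar a b
    rw [D.slice_mul_rep, D.slice_rep_mul, hc]
    simp
  rw [← VonNeumannAlgebra.commutant_commutant P, VonNeumannAlgebra.mem_commutant_iff]
  intro x hx
  have hMP : M ≤ P.commutant := fun m hm => VonNeumannAlgebra.mem_commutant_iff.2 fun p hp =>
    (VonNeumannAlgebra.mem_commutant_iff.1 (hP hp) m hm).symm
  refine D.ext_of_star_col hM fun η ζ => ?_
  have hcol : ∀ η, D.col η * z = z * D.col η := fun η => hzM _ (D.col_mem η)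
  have hscol : ∀ η, star (D.col η) * z = z * star (D.col η) := fun η =>
    hzM _ (star_mem (D.col_mem η))
  -- Each matrix block `y` of `x` lies in the commutant of `P`. Its amplification `t` commutes with
  -- `N` and `P`, hence with `z`; compressing back, `y` commutes with `z`.
  set y := star (D.col η) * x * D.col ζ with hy
  have hyP : y ∈ P.commutant :=
    mul_mem (mul_mem (star_mem (hMP (D.col_mem η))) hx) (hMP (D.col_mem ζ))
  obtain ⟨t, ht⟩ := D.exists_amplification (T := y)
    (by rw [hy, ← mul_assoc, ← mul_assoc, D.proj_mul_star_col])
    (by rw [hy, mul_assoc, D.col_mul_proj])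
  have htM : ∀ m ∈ M, m * t = t * m := by
    intro m hm
    obtain ⟨k, rfl⟩ := D.exists_rep_eq m hm
    refine D.ext_of_mul_col hM fun θ => ?_
    rw [mul_assoc, ht, ← mul_assoc, D.rep_mul_col, mul_assoc, D.rep_mul_col, ht]
  have htP : ∀ p ∈ P, p * t = t * p := by
    intro p hp
    have hpcol : ∀ θ, D.col θ * p = p * D.col θ := fun θ =>
      VonNeumannAlgebra.mem_commutant_iff.1 (hP hp) _ (D.col_mem θ)
    refine D.ext_of_mul_col hM fun θ => ?_
    rw [mul_assoc, ht, mul_assoc, ← hpcol, ← mul_assoc t, ht, ← mul_assoc, ← hpcol, mul_assoc,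
      mul_assoc, VonNeumannAlgebra.mem_commutant_iff.1 hyP p hp]
  have htz : t * z = z * t := by
    refine hz t ?_
    rintro n (hn | hn)
    · exact htM n (hN hn)
    · exact htP n hn
  have hyz : y * z = z * y := by
    have h1 : D.proj * y = y := by rw [hy, ← mul_assoc, ← mul_assoc, D.proj_mul_star_col]
    have h2 : t * D.proj = y := by
      rw [TypeIData.proj, ht]; exact h1
    rw [← h2, mul_assoc, TypeIData.proj, hcol, ← mul_assoc, htz, mul_assoc]
  rw [← mul_assoc, mul_assoc _ z, ← hcol, ← mul_assoc, ← hy, hyz, hy, ← mul_assoc (star _) z x, hscol]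
  simp only [mul_assoc]

/-- If a unitary `W` in the von Neumann algebra generated by the commuting algebras `N ⊆ M` and
`P ⊆ M'` normalizes the factor `N`, then its action on `N` is inner. -/
theorem exists_unitary_implementing {M : VonNeumannAlgebra H} (hMI : IsTypeIFactor M) {N P : VonNeumannAlgebra H}
    (hNf : IsFactor N) (hN : N ≤ M) (hP : P ≤ M.commutant) {W : H →L[ℂ] H}
    (hW : W ∈ Set.centralizer (Set.centralizer ((N : Set (H →L[ℂ] H)) ∪ P)))
    (hWu : W ∈ unitary (H →L[ℂ] H)) (hW1 : ∀ x ∈ N, W * x * star W ∈ N)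
    (hW2 : ∀ x ∈ N, star W * x * W ∈ N) :
    ∃ w ∈ unitary (H →L[ℂ] H), w ∈ N ∧ ∀ x ∈ N, w * x * star w = W * x * star W := by
  rcases subsingleton_or_nontrivial H with hH | hH
  · exact ⟨W, hWu, by rw [Subsingleton.elim W 0]; exact zero_mem N, fun _ _ => rfl⟩
  obtain ⟨K, _, _, _, ⟨D⟩⟩ := hMI.exists_typeIData
  have hM := hMI.1
  obtain ⟨hsW, hWs⟩ := Unitary.mem_iff.1 hWu
  have hne : ∃ h k, D.slice h k W ≠ 0 := by
    by_contra! hcon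
    have hW0 : W = 0 := D.ext_of_slice hM fun h k => by
      rw [hcon]; simp [TypeIData.slice]
    apply D.proj_ne_zero
    rw [← mul_one D.proj, ← hsW, hW0, mul_zero, mul_zero]
  obtain ⟨h, k, hhk⟩ := hne
  -- A nonzero slice of `W` lies in `N` and intertwines the identity with Ad W on `N`. Then e*e and
  -- ee* are central in the factor `N`, so `e` is a multiple of the required unitary.
  set e := D.rep (D.slice h k W) with he
  have heN : e ∈ N := D.rep_slice_mem hM hN hP hW h k
  have he0 : e ≠ 0 := fun h0 => hhk (D.rep_injective (by rw [← he, h0, map_zero]))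
  have hint : ∀ x ∈ N, e * x = W * x * star W * e := by
    intro x hx
    obtain ⟨a, ha⟩ := D.exists_rep_eq _ (hN hx)
    obtain ⟨b, hb⟩ := D.exists_rep_eq _ (hN (hW1 x hx))
    rw [← hb, ← ha, he, ← map_mul, ← map_mul, ← D.slice_rep_mul, ← D.slice_mul_rep, ha, hb,
      mul_assoc _ (star W), hsW, mul_one]
  have hint' : ∀ x ∈ N, x * star e = star e * (W * x * star W) := by
    intro x hx
    have := congrArg star (hint (star x) (star_mem hx))
    simpa [mul_assoc] using this
  obtain ⟨c, hc⟩ := hNf (star e * e) (mul_mem (star_mem heN) heN) (by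
    rw [VonNeumannAlgebra.mem_commutant_iff]
    intro x hx
    rw [← mul_assoc, hint' x hx, mul_assoc, ← hint x hx, mul_assoc])
  obtain ⟨d, hd⟩ := hNf (e * star e) (mul_mem heN (star_mem heN)) (by
    rw [VonNeumannAlgebra.mem_commutant_iff]
    intro x hx
    have hx' : W * (star W * x * W) * star W = x := by
      simp only [mul_assoc, hWs, mul_one]
      rw [← mul_assoc, hWs, one_mul]
    have h1 := hint _ (hW2 x hx)
    have h2 := hint' _ (hW2 x hx)
    rw [hx'] at h1 h2
    rw [← mul_assoc, ← h1, mul_assoc, h2, mul_assoc])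
  have hcd : c = d := by
    have h1 : e * (star e * e) = (e * star e) * e := (mul_assoc _ _ _).symm
    rw [hc, hd, mul_smul_comm, smul_mul_assoc, one_mul, mul_one] at h1
    exact smul_left_injective ℂ he0 h1
  obtain ⟨v, hv⟩ := exists_norm_eq H (zero_le_one (α := ℝ))
  have hcv : c = ((‖e v‖ ^ 2 : ℝ) : ℂ) := by
    have h1 : inner ℂ v ((star e * e) v) = inner ℂ (e v) (e v) := by
      rw [mul_apply_eq_comp, ContinuousLinearMap.star_eq_adjoint,
        ContinuousLinearMap.adjoint_inner_right]
    rw [hc, inner_self_eq_norm_sq_to_K] at h1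
    simp only [smul_apply, one_apply_eq_self, inner_smul_right,
      inner_self_eq_norm_sq_to_K, hv] at h1
    simpa using h1
  have hc0 : c ≠ 0 := by
    rintro rfl
    rw [zero_smul] at hc
    exact he0 ((CStarRing.star_mul_self_eq_zero_iff e).1 hc)
  have hev : ‖e v‖ ≠ 0 := by
    intro h0
    apply hc0
    rw [hcv, h0]; simp
  set r : ℂ := ((‖e v‖⁻¹ : ℝ) : ℂ) with hr
  have hrs : star r = r := Complex.conj_ofReal _
  have hrc : r * r * c = 1 := by
    rw [hr, hcv, ← Complex.ofReal_mul, ← Complex.ofReal_mul]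
    norm_cast
    field_simp
  have hw2 : (r • e) * star (r • e) = 1 := by
    rw [star_smul, hrs, smul_mul_smul_comm, hd, ← hcd, smul_smul, hrc, one_smul]
  refine ⟨r • e, Unitary.mem_iff.2 ⟨?_, hw2⟩, N.toStarSubalgebra.smul_mem heN r, ?_⟩
  · rw [star_smul, hrs, smul_mul_smul_comm, hc, smul_smul, hrc, one_smul]
  · intro x hx
    rw [smul_mul_assoc, hint x hx, ← mul_smul_comm, mul_assoc, hw2, mul_one]

end TypeI

/-! ### Geometry of double cones -/

namespace DoubleCone

/-- The order of double cones by inclusion, in light-cone coordinates. -/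
structure Within (O₁ O₂ : DoubleCone) : Prop where
  a : O₂.a ≤ O₁.a
  b : O₁.b ≤ O₂.b
  c : O₂.c ≤ O₁.c
  d : O₁.d ≤ O₂.d

theorem Within.subset {O₁ O₂ : DoubleCone} (h : O₁.Within O₂) : O₁.carrier ⊆ O₂.carrier :=
  fun _ ⟨h1, h2, h3, h4⟩ => ⟨h.a.trans_lt h1, h2.trans_le h.b, h.c.trans_lt h3, h4.trans_le h.d⟩

/-- `R` lies in the right spacelike complement of `L`. -/
structure LeftOf (L R : DoubleCone) : Prop where
  u : R.b ≤ L.a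
  v : L.d ≤ R.c

theorem LeftOf.subset_right {L R : DoubleCone} (h : L.LeftOf R) :
    R.carrier ⊆ L.rightComplement := by
  rintro p ⟨h1, h2, h3, h4⟩ q ⟨h5, h6, h7, h8⟩
  have := h.u
  have := h.v
  rw [abs_lt]
  constructor <;> linarith

theorem LeftOf.subset_spacelike {L R : DoubleCone} (h : L.LeftOf R) :
    R.carrier ⊆ L.spacelikeComplement := fun _ hp q hq =>
  (h.subset_right hp q hq).trans_le (le_abs_self _)

theorem mem_carrier_of_lightcone (O : DoubleCone) {u v : ℝ} (h1 : O.a < u) (h2 : u < O.b)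
    (h3 : O.c < v) (h4 : v < O.d) : (((u + v) / 2, (v - u) / 2) : Minkowski) ∈ O.carrier := by
  refine ⟨?_, ?_, ?_, ?_⟩ <;> dsimp only <;> linarith

/-- If one of the two light-cone inequalities failed, there would be points p of `L` and q of `R` in
the wrong order in that coordinate, so that p is not spacelike to the left of q. -/
theorem leftOf_of_subset_left {L R : DoubleCone} (h : L.carrier ⊆ R.leftComplement) :
    L.LeftOf R := by
  have hLu := L.hab
  have hLv := L.hcd
  have hRu := R.hab
  have hRv := R.hcd
  constructor
  · by_contra! hcon
    obtain ⟨u, hu1, hu2⟩ := exists_between (lt_min hLu hcon)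
    obtain ⟨w, hw1, hw2⟩ := exists_between (max_lt hRu (hu2.trans_le (min_le_right _ _)))
    have := h (L.mem_carrier_of_lightcone hu1 (hu2.trans_le (min_le_left _ _))
      (left_lt_add_div_two.2 hLv) (add_div_two_lt_right.2 hLv)) _
      (R.mem_carrier_of_lightcone ((le_max_left _ _).trans_lt hw1) hw2
      (left_lt_add_div_two.2 hRv) (add_div_two_lt_right.2 hRv))
    have h1 := (le_max_right _ _).trans_lt hw1
    have := (abs_lt.1 this).1
    dsimp only at this
    linarith
  · by_contra! hcon
    obtain ⟨u, hu1, hu2⟩ := exists_between (max_lt hLv hcon)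
    obtain ⟨w, hw1, hw2⟩ := exists_between (lt_min hRv ((le_max_right _ _).trans_lt hu1))
    have := h (L.mem_carrier_of_lightcone (left_lt_add_div_two.2 hLu) (add_div_two_lt_right.2 hLu)
      ((le_max_left _ _).trans_lt hu1) hu2) _
      (R.mem_carrier_of_lightcone (left_lt_add_div_two.2 hRu) (add_div_two_lt_right.2 hRu)
      hw1 (hw2.trans_le (min_le_left _ _)))
    have h1 := hw2.trans_le (min_le_right _ _)
    have := (abs_lt.1 this).2
    dsimp only at this
    linarith

theorem leftOf_of_subset_right {L R : DoubleCone} (h : R.carrier ⊆ L.rightComplement) :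
    L.LeftOf R := by
  refine leftOf_of_subset_left fun p hp q hq => ?_
  rw [abs_sub_comm]
  exact h hq p hp

/-- The double cone `X` is cut at an interior point into its parts `L` to the left and `R` to the
right of this point. -/
structure IsCut (X L R : DoubleCone) : Prop where
  la : L.a = R.b
  lb : L.b = X.b
  lc : L.c = X.c
  ld : L.d = R.c
  ra : R.a = X.a
  rd : R.d = X.d

theorem IsCut.left_within {X L R : DoubleCone} (h : X.IsCut L R) : L.Within X :=
  ⟨by rw [h.la, ← h.ra]; exact R.hab.le, h.lb.le, h.lc.ge,
    by rw [h.ld, ← h.rd]; exact R.hcd.le⟩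

theorem IsCut.right_within {X L R : DoubleCone} (h : X.IsCut L R) : R.Within X :=
  ⟨h.ra.ge, by rw [← h.la, ← h.lb]; exact L.hab.le, by rw [← h.lc, ← h.ld]; exact L.hcd.le,
    h.rd.le⟩

end DoubleCone

/-! ### Unitaries and commutants -/

section Unitaries

variable {H : Type u} [NormedAddCommGroup H] [InnerProductSpace ℂ H] [CompleteSpace H]

/-- This turns agreement of two inner actions into a commutant condition, which can be propagated to
generated von Neumann algebras. -/
theorem mul_conj_eq_iff {T S x : H →L[ℂ] H} (hT : T ∈ unitary (H →L[ℂ] H))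
    (hS : S ∈ unitary (H →L[ℂ] H)) :
    T * x * star T = S * x * star S ↔ x * (star S * T) = (star S * T) * x := by
  obtain ⟨hT1, hT2⟩ := Unitary.mem_iff.1 hT
  obtain ⟨hS1, hS2⟩ := Unitary.mem_iff.1 hS
  constructor
  · intro h
    calc x * (star S * T) = star S * (S * x * star S) * T := by
          simp only [← mul_assoc, hS1, one_mul]
      _ = star S * T * x := by
          rw [← h]; simp only [mul_assoc, hT1, mul_one]
  · intro h
    calc T * x * star T = S * ((star S * T) * x) * star T := by
          simp only [← mul_assoc, hS2, one_mul]
      _ = S * x * star S := by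
          rw [← h]; simp only [mul_assoc, hT2, mul_one]

theorem conj_eq_iff_eq_conj {T x y : H →L[ℂ] H} (hT : T ∈ unitary (H →L[ℂ] H)) :
    T * x * star T = y ↔ x = star T * y * T := by
  obtain ⟨hT1, hT2⟩ := Unitary.mem_iff.1 hT
  constructor
  · rintro rfl
    simp only [mul_assoc, hT1, mul_one]; simp only [← mul_assoc, hT1, one_mul]
  · rintro rfl
    simp only [mul_assoc, hT2, mul_one]; simp only [← mul_assoc, hT2, one_mul]

end Unitaries

/-! ### Nets with the split property and minimal relative commutants -/

namespace LocalNet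

variable {H : Type u} [NormedAddCommGroup H] [InnerProductSpace ℂ H] [CompleteSpace H]
  {F : LocalNet H}

theorem alg_mono {O₁ O₂ : DoubleCone} (h : O₁.Within O₂) : F.alg O₁ ≤ F.alg O₂ :=
  F.isotone _ _ h.subset

theorem alg_le_region {O : DoubleCone} {S : Set Minkowski} (h : O.carrier ⊆ S) {A : H →L[ℂ] H}
    (hA : A ∈ F.alg O) : A ∈ F.region S :=
  StarSubalgebra.le_topologicalClosure _
    ((le_iSup₂_of_le (f := fun (O : DoubleCone) (_ : O.carrier ⊆ S) => (F.alg O).toStarSubalgebra)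
      O h le_rfl) hA)

theorem HaagDuality.commute (hF : F.HaagDuality) {L R : DoubleCone} (h : L.LeftOf R)
    {x y : H →L[ℂ] H} (hx : x ∈ F.alg L) (hy : y ∈ F.alg R) : x * y = y * x := by
  have h1 : x ∈ (F.alg L : Set (H →L[ℂ] H)) := hx
  rw [hF L] at h1
  exact (h1 y (alg_le_region h.subset_spacelike hy)).symm

/-- Local algebras are generated by the algebras of the two parts of a cut double cone. -/
theorem mem_commutant_of_isCut (hs : F.SplitProperty) (hf : F.LocalFactors)
    (hm : F.MinimalRelativeCommutants) {X L R : DoubleCone} (h : X.IsCut L R) {z : H →L[ℂ] H}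
    (hL : z ∈ (F.alg L).commutant) (hR : z ∈ (F.alg R).commutant) :
    z ∈ (F.alg X).commutant := by
  have hLu := L.hab
  have hLv := L.hcd
  have hRu := R.hab
  have hRv := R.hcd
  obtain ⟨h1, h2, h3, h4, h5, h6⟩ := h
  -- The inner cone is the corner of `L` at the cut point. Thus the right relative complement is
  -- exactly `R`, and the left one lies in `L`.
  let Λ : ConePair :=
    { inner := ⟨L.a, (L.a + L.b) / 2, (L.c + L.d) / 2, L.d, by linarith, by linarith⟩
      outer := X
      ha := by dsimp only; linarith
      hb := by dsimp only; linarith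
      hc := by dsimp only; linarith
      hd := by dsimp only; linarith }
  have hΛr : Λ.right = R := by
    ext
    · exact h5.symm
    · exact h1
    · exact h4
    · exact h6.symm
  have hΛl : F.alg Λ.left ≤ F.alg L := alg_mono
    ⟨by dsimp [Λ, ConePair.left]; linarith, by dsimp [Λ, ConePair.left]; linarith,
      by dsimp [Λ, ConePair.left]; linarith, by dsimp [Λ, ConePair.left]; linarith⟩
  have hΛi : F.alg Λ.inner ≤ F.alg L := alg_mono
    ⟨le_rfl, by dsimp [Λ]; linarith, by dsimp [Λ]; linarith, le_rfl⟩
  obtain ⟨M, hM, hM1, hM2⟩ := hs Λ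
  have hzi : z ∈ (F.alg Λ.inner).commutant := VonNeumannAlgebra.mem_commutant_iff.2
    fun x hx => VonNeumannAlgebra.mem_commutant_iff.1 hL x (hΛi hx)
  -- By minimality, `z` commutes with F(X) ∩ F(inner)', so it lies in the algebra generated by
  -- F(inner) and F(X)'. As `z` also commutes with F(inner), only the F(X)' component remains.
  refine mem_of_mem_generated_of_mem_commutant hM (hf Λ.inner) hM1
    (P := (F.alg X).commutant) ?_ ?_ hzi
  · intro x hx
    exact VonNeumannAlgebra.mem_commutant_iff.2
      fun m hm' => VonNeumannAlgebra.mem_commutant_iff.1 hx m (hM2 hm')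
  · intro t ht
    have ht1 : t ∈ (F.alg Λ.outer : Set (H →L[ℂ] H)) := by
      change t ∈ F.alg X
      rw [← VonNeumannAlgebra.commutant_commutant (F.alg X), VonNeumannAlgebra.mem_commutant_iff]
      exact fun x hx => ht x (Or.inr hx)
    have ht2 : t ∈ Set.centralizer (F.alg Λ.inner : Set (H →L[ℂ] H)) :=
      fun x hx => ht x (Or.inl hx)
    have ht3 := (hm Λ).subset ⟨ht1, ht2⟩
    refine (ht3 z ?_).symm
    rintro x (hx | hx)
    · rw [hΛr] at hx
      exact VonNeumannAlgebra.mem_commutant_iff.1 hR x hx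
    · exact VonNeumannAlgebra.mem_commutant_iff.1 hL x (hΛl hx)

/-- Passing to commutants: for z in F(X)', the operator T*zT commutes with the algebras of both
parts, hence with F(X). -/
theorem conj_mem_of_isCut (hs : F.SplitProperty) (hf : F.LocalFactors)
    (hm : F.MinimalRelativeCommutants) {X L R : DoubleCone} (h : X.IsCut L R) {T : H →L[ℂ] H}
    (hT : T ∈ unitary (H →L[ℂ] H))
    (hL : ∀ x ∈ F.alg L, T * x * star T ∈ F.alg L)
    (hR : ∀ x ∈ F.alg R, T * x * star T ∈ F.alg R) {x : H →L[ℂ] H} (hx : x ∈ F.alg X) :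
    T * x * star T ∈ F.alg X := by
  have hTs : star T ∈ unitary (H →L[ℂ] H) := Unitary.star_mem hT
  obtain ⟨hT1, hT2⟩ := Unitary.mem_iff.1 hT
  have key : ∀ y z : H →L[ℂ] H, (T * y * star T) * z = z * (T * y * star T) ↔
      y * (star T * z * T) = (star T * z * T) * y := by
    intro y z
    have e1 : y * (star T * z * T) = star T * ((T * y * star T) * z) * T := by
      simp only [← mul_assoc, hT1, one_mul]
    have e2 : (star T * z * T) * y = star T * (z * (T * y * star T)) * T := by
      simp only [mul_assoc, hT1, mul_one]
    rw [e1, e2]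
    constructor
    · intro h; rw [h]
    · intro h
      have := congrArg (fun w => T * w * star T) h
      simp only [mul_assoc, hT2, mul_one] at this
      simp only [← mul_assoc, hT2, one_mul] at this
      simpa only [mul_assoc] using this
  rw [← VonNeumannAlgebra.commutant_commutant (F.alg X), VonNeumannAlgebra.mem_commutant_iff]
  intro z hz
  rw [VonNeumannAlgebra.mem_commutant_iff] at hz
  have hz' : star T * z * T ∈ (F.alg X).commutant := by
    apply mem_commutant_of_isCut hs hf hm h <;> rw [VonNeumannAlgebra.mem_commutant_iff] <;>
      intro y hy <;> rw [← key]
    · exact hz _ (alg_mono h.left_within (hL y hy))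
    · exact hz _ (alg_mono h.right_within (hR y hy))
  exact ((key x z).2 (VonNeumannAlgebra.mem_commutant_iff.1 hz' x hx)).symm

theorem conj_eq_conj_of_isCut (hs : F.SplitProperty) (hf : F.LocalFactors)
    (hm : F.MinimalRelativeCommutants) {X L R : DoubleCone} (h : X.IsCut L R) {S T : H →L[ℂ] H}
    (hS : S ∈ unitary (H →L[ℂ] H)) (hT : T ∈ unitary (H →L[ℂ] H))
    (hL : ∀ x ∈ F.alg L, S * x * star S = T * x * star T)
    (hR : ∀ x ∈ F.alg R, S * x * star S = T * x * star T) {x : H →L[ℂ] H} (hx : x ∈ F.alg X) :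
    S * x * star S = T * x * star T := by
  rw [mul_conj_eq_iff hS hT]
  refine VonNeumannAlgebra.mem_commutant_iff.1 (mem_commutant_of_isCut hs hf hm h ?_ ?_) x hx <;>
    rw [VonNeumannAlgebra.mem_commutant_iff] <;> intro y hy <;> rw [← mul_conj_eq_iff hS hT]
  · exact hL y hy
  · exact hR y hy

end LocalNet

/-! ### Limits of inner automorphisms -/

section Limits

variable {A : Type u} [CStarAlgebra A]

theorem norm_unitary_conj_le {T : A} (hT : T ∈ unitary A) (x : A) : ‖T * x * star T‖ ≤ ‖x‖ := by
  rw [CStarRing.norm_mul_mem_unitary _ (Unitary.star_mem hT), CStarRing.norm_mem_unitary_mul _ hT]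

/-- The conjugations are isometric and eventually constant at each point of a dense set, so they
form Cauchy sequences everywhere. -/
theorem exists_tendsto_unitary_conj {s : ℕ → Set A} (hs : Dense (⋃ n, s n)) {T : ℕ → A}
    (hT : ∀ n, T n ∈ unitary A)
    (hc : ∀ m n, m ≤ n → ∀ x ∈ s m, T n * x * star (T n) = T m * x * star (T m)) (x : A) :
    ∃ y, Filter.Tendsto (fun n => T n * x * star (T n)) Filter.atTop (nhds y) := by
  refine cauchySeq_tendsto_of_complete (Metric.cauchySeq_iff'.2 fun ε hε => ?_)
  obtain ⟨y, hy, hxy⟩ := hs.exists_dist_lt x (half_pos hε)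
  obtain ⟨m, hm⟩ := Set.mem_iUnion.1 hy
  refine ⟨m, fun n hn => ?_⟩
  have h1 : ∀ k, dist (T k * x * star (T k)) (T k * y * star (T k)) < ε / 2 := by
    intro k
    rw [dist_eq_norm, ← sub_mul, ← mul_sub]
    refine (norm_unitary_conj_le (hT k) _).trans_lt ?_
    rwa [← dist_eq_norm]
  calc dist (T n * x * star (T n)) (T m * x * star (T m))
      ≤ dist (T n * x * star (T n)) (T n * y * star (T n)) +
        dist (T n * y * star (T n)) (T m * x * star (T m)) := dist_triangle _ _ _
    _ < ε / 2 + ε / 2 := by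
        refine add_lt_add (h1 n) ?_
        rw [hc m n hn y hm, dist_comm]
        exact h1 m
    _ = ε := add_halves ε

theorem exists_starAlgHom_eq_unitary_conj {s : ℕ → Set A} (hs : Dense (⋃ n, s n)) {T : ℕ → A}
    (hT : ∀ n, T n ∈ unitary A)
    (hc : ∀ m n, m ≤ n → ∀ x ∈ s m, T n * x * star (T n) = T m * x * star (T m)) :
    ∃ ρ : A →⋆ₐ[ℂ] A, ∀ n, ∀ x ∈ s n, ρ x = T n * x * star (T n) := by
  choose ρ hρ using exists_tendsto_unitary_conj hs hT hc
  have hρu : ∀ x y, Filter.Tendsto (fun n => T n * x * star (T n)) Filter.atTop (nhds y) →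
      ρ x = y := fun x y h => tendsto_nhds_unique (hρ x) h
  have hscalar : ∀ r : ℂ, ρ (algebraMap ℂ A r) = algebraMap ℂ A r := by
    intro r
    refine hρu _ _ ((tendsto_const_nhds).congr fun n => ?_)
    rw [← Algebra.commutes, mul_assoc, Unitary.mul_star_self_of_mem (hT n), mul_one]
  refine ⟨
    { toFun := ρ
      map_one' := by simpa using hscalar 1
      map_zero' := by simpa using hscalar 0
      commutes' := hscalar
      map_mul' := fun x y => hρu _ _ (((hρ x).mul (hρ y)).congr fun n => ?_)
      map_add' := fun x y => hρu _ _ (((hρ x).add (hρ y)).congr fun n => ?_)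
      map_star' := fun x => hρu _ _ ((hρ x).star.congr fun n => ?_) }, ?_⟩
  · rw [mul_assoc, mul_assoc, ← mul_assoc (star (T n)), ← mul_assoc (star (T n)),
      Unitary.star_mul_self_of_mem (hT n)]
    simp only [one_mul, mul_assoc]
  · rw [mul_add, add_mul]
  · simp only [star_mul, star_star, mul_assoc]
  · intro n x hx
    refine hρu _ _ (tendsto_const_nhds.congr' ?_)
    filter_upwards [Filter.eventually_ge_atTop n] with m hm
    exact (hc n m hm x hx).symm

theorem exists_starAlgEquiv_eq_unitary_conj {s : ℕ → Set A} (hs : Dense (⋃ n, s n)) {T : ℕ → A}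
    (hT : ∀ n, T n ∈ unitary A)
    (hc : ∀ m n, m ≤ n → ∀ x ∈ s m, T n * x * star (T n) = T m * x * star (T m))
    (h1 : ∀ n, ∀ x ∈ s n, T n * x * star (T n) ∈ s n)
    (h2 : ∀ n, ∀ x ∈ s n, star (T n) * x * T n ∈ s n) :
    ∃ ρ : A ≃⋆ₐ[ℂ] A, ∀ n, ∀ x ∈ s n, ρ x = T n * x * star (T n) := by
  have e1 : ∀ n x, T n * (star (T n) * x * T n) * star (T n) = x := fun n x => by
    simp only [mul_assoc, Unitary.mul_star_self_of_mem (hT n), mul_one]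
    simp only [← mul_assoc, Unitary.mul_star_self_of_mem (hT n), one_mul]
  have e2 : ∀ n x, star (T n) * (T n * x * star (T n)) * T n = x := fun n x => by
    simp only [mul_assoc, Unitary.star_mul_self_of_mem (hT n), mul_one]
    simp only [← mul_assoc, Unitary.star_mul_self_of_mem (hT n), one_mul]
  obtain ⟨ρ, hρ⟩ := exists_starAlgHom_eq_unitary_conj hs hT hc
  -- The inverse is the limit of the inverse conjugations; these are compatible because each `s n`
  -- is stable under them.
  obtain ⟨σ, hσ⟩ := exists_starAlgHom_eq_unitary_conj hs (T := fun n => star (T n))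
    (fun n => Unitary.star_mem (hT n)) (fun m n hmn x hx => by
      have := hc m n hmn _ (h2 m x hx)
      rw [e1] at this
      rw [star_star, star_star, ← e2 n (star (T m) * x * T m), this])
  simp only [star_star] at hσ
  have hρc : Continuous ρ := map_continuous ρ
  have hσc : Continuous σ := map_continuous σ
  have hρσ : ρ.comp σ = .id ℂ A := by
    refine DFunLike.coe_injective (Continuous.ext_on hs (hρc.comp hσc) continuous_id ?_)
    rintro x hx
    obtain ⟨n, hn⟩ := Set.mem_iUnion.1 hx
    simp [hσ n x hn, hρ n _ (h2 n x hn), e1]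
  have hσρ : σ.comp ρ = .id ℂ A := by
    refine DFunLike.coe_injective (Continuous.ext_on hs (hσc.comp hρc) continuous_id ?_)
    rintro x hx
    obtain ⟨n, hn⟩ := Set.mem_iUnion.1 hx
    simp [hρ n x hn, hσ n _ (h1 n x hn), e2]
  exact ⟨StarAlgEquiv.ofStarAlgHom ρ σ hσρ hρσ, hρ⟩

end Limits

/-! ### The quasilocal algebra as a norm closure -/

namespace LocalNet

variable {H : Type u} [NormedAddCommGroup H] [InnerProductSpace ℂ H] [CompleteSpace H]
  {F : LocalNet H}

instance isClosed_quasilocal : IsClosed (F.quasilocal : Set (H →L[ℂ] H)) :=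
  StarSubalgebra.isClosed_topologicalClosure _

theorem mem_quasilocal {O : DoubleCone} {x : H →L[ℂ] H} (hx : x ∈ F.alg O) : x ∈ F.quasilocal :=
  alg_le_region (Set.subset_univ _) hx

theorem eqOn_region {S : Set Minkowski} {f g : F.quasilocal →⋆ₐ[ℂ] F.quasilocal}
    (h : ∀ O : DoubleCone, O.carrier ⊆ S → ∀ A : F.quasilocal, (A : H →L[ℂ] H) ∈ F.alg O →
      f A = g A) (A : F.quasilocal) (hA : (A : H →L[ℂ] H) ∈ F.region S) : f A = g A := by
  have hcl : IsClosed {A : F.quasilocal | f A = g A} :=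
    isClosed_eq (map_continuous f) (map_continuous g)
  have hle : F.region S ≤ (StarAlgHom.equalizer f g).map F.quasilocal.subtype := by
    refine StarSubalgebra.topologicalClosure_minimal (iSup₂_le fun O hO x hx => ?_) ?_
    · exact ⟨⟨x, mem_quasilocal hx⟩, h O hO _ hx, rfl⟩
    · exact (isClosed_quasilocal.isClosedEmbedding_subtypeVal.isClosedMap) _ hcl
  obtain ⟨B, hB, hBA⟩ := hle hA
  have : B = A := Subtype.ext hBA
  exact this ▸ hB

theorem aut_ext {ρ σ : F.Aut} (h : ∀ O : DoubleCone, ∀ A : F.quasilocal,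
    (A : H →L[ℂ] H) ∈ F.alg O → ρ A = σ A) : ρ = σ :=
  StarAlgEquiv.ext fun A => eqOn_region (f := (ρ : F.quasilocal →⋆ₐ[ℂ] F.quasilocal))
    (g := (σ : F.quasilocal →⋆ₐ[ℂ] F.quasilocal)) (fun O _ => h O) A A.2

theorem dense_iUnion_alg {K : ℕ → DoubleCone} (hK : ∀ m n, m ≤ n → (K m).Within (K n))
    (hK' : ∀ O : DoubleCone, ∃ n, O.Within (K n)) :
    Dense (⋃ n, {A : F.quasilocal | (A : H →L[ℂ] H) ∈ F.alg (K n)}) := by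
  let S : StarSubalgebra ℂ (H →L[ℂ] H) :=
    { carrier := {x | ∃ n, x ∈ F.alg (K n)}
      mul_mem' := by
        rintro x y ⟨m, hx⟩ ⟨n, hy⟩
        exact ⟨max m n, mul_mem (alg_mono (hK _ _ (le_max_left _ _)) hx)
          (alg_mono (hK _ _ (le_max_right _ _)) hy)⟩
      add_mem' := by
        rintro x y ⟨m, hx⟩ ⟨n, hy⟩
        exact ⟨max m n, add_mem (alg_mono (hK _ _ (le_max_left _ _)) hx)
          (alg_mono (hK _ _ (le_max_right _ _)) hy)⟩
      algebraMap_mem' := fun r => ⟨0, (F.alg (K 0)).toStarSubalgebra.algebraMap_mem r⟩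
      star_mem' := by
        rintro x ⟨m, hx⟩
        exact ⟨m, star_mem hx⟩ }
  have hle : (⨆ (O : DoubleCone) (_ : O.carrier ⊆ Set.univ), (F.alg O).toStarSubalgebra) ≤ S :=
    iSup₂_le fun O _ x hx => by
      obtain ⟨n, hn⟩ := hK' O
      exact ⟨n, alg_mono hn hx⟩
  intro A
  rw [closure_subtype]
  refine closure_mono ?_ (StarSubalgebra.topologicalClosure_mono hle A.2)
  rintro x ⟨n, hx⟩
  exact ⟨⟨x, mem_quasilocal hx⟩, Set.mem_iUnion.2 ⟨n, hx⟩, rfl⟩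

end LocalNet

/-! ### Local implementers -/

section Conjugation

variable {H : Type u} [NormedAddCommGroup H] [InnerProductSpace ℂ H] [CompleteSpace H]

theorem conj_mem_of_image_eq {T : H →L[ℂ] H} (hT : T ∈ unitary (H →L[ℂ] H))
    {S : Set (H →L[ℂ] H)} (h : (fun x => T * x * star T) '' S = S) {x : H →L[ℂ] H} (hx : x ∈ S) :
    T * x * star T ∈ S ∧ star T * x * T ∈ S := by
  refine ⟨h ▸ Set.mem_image_of_mem _ hx, ?_⟩
  rw [← h] at hx
  obtain ⟨y, hy, hyx⟩ := hx
  rwa [← (conj_eq_iff_eq_conj hT).1 hyx]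

theorem conj_eq_self {T x : H →L[ℂ] H} (hT : T ∈ unitary (H →L[ℂ] H)) (h : T * x = x * T) :
    T * x * star T = x := by
  rw [h, mul_assoc, Unitary.mul_star_self_of_mem hT, mul_one]

theorem star_conj_eq_self {T x : H →L[ℂ] H} (hT : T ∈ unitary (H →L[ℂ] H))
    (h : T * x = x * T) : star T * x * T = x := by
  rw [mul_assoc, ← h, ← mul_assoc, Unitary.star_mul_self_of_mem hT, one_mul]

end Conjugation

namespace LocalNet

variable {H : Type u} [NormedAddCommGroup H] [InnerProductSpace ℂ H] [CompleteSpace H]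
  {F : LocalNet H} {G : Type v} [Group G] {α : F.Symmetry G}

theorem conj_both_mem_of_isCut (hs : F.SplitProperty) (hf : F.LocalFactors)
    (hm : F.MinimalRelativeCommutants) {X L R : DoubleCone} (h : X.IsCut L R) {T : H →L[ℂ] H}
    (hT : T ∈ unitary (H →L[ℂ] H))
    (hL : ∀ x ∈ F.alg L, T * x * star T ∈ F.alg L ∧ star T * x * T ∈ F.alg L)
    (hR : ∀ x ∈ F.alg R, T * x * star T ∈ F.alg R ∧ star T * x * T ∈ F.alg R)
    {x : H →L[ℂ] H} (hx : x ∈ F.alg X) :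
    T * x * star T ∈ F.alg X ∧ star T * x * T ∈ F.alg X := by
  refine ⟨conj_mem_of_isCut hs hf hm h hT (fun x hx => (hL x hx).1) (fun x hx => (hR x hx).1) hx,
    ?_⟩
  have := conj_mem_of_isCut hs hf hm h (Unitary.star_mem hT)
    (fun x hx => by rw [star_star]; exact (hL x hx).2)
    (fun x hx => by rw [star_star]; exact (hR x hx).2) hx
  rwa [star_star] at this

theorem coe_mem_unitary {U : F.quasilocal} (hU : U ∈ unitary F.quasilocal) :
    (U : H →L[ℂ] H) ∈ unitary (H →L[ℂ] H) :=
  Unitary.mem_iff.2 ⟨congrArg Subtype.val (Unitary.mem_iff.1 hU).1,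
    congrArg Subtype.val (Unitary.mem_iff.1 hU).2⟩

theorem mem_unitary_of_coe {U : F.quasilocal} (hU : (U : H →L[ℂ] H) ∈ unitary (H →L[ℂ] H)) :
    U ∈ unitary F.quasilocal :=
  Unitary.mem_iff.2 ⟨Subtype.ext (Unitary.mem_iff.1 hU).1, Subtype.ext (Unitary.mem_iff.1 hU).2⟩

namespace IsLocalImplementer

variable {g : G} {Λ : ConePair} {U : F.quasilocal}

theorem conj_coe (h : F.IsLocalImplementer α g Λ U) {A : F.quasilocal}
    (hA : (A : H →L[ℂ] H) ∈ F.alg Λ.inner) :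
    (U : H →L[ℂ] H) * A * star (U : H →L[ℂ] H) = α.toHom g A :=
  congrArg Subtype.val (h.implements A hA)

theorem conj_mem_of_within (h : F.IsLocalImplementer α g Λ U) {O : DoubleCone}
    (hO : O.Within Λ.inner) {x : H →L[ℂ] H} (hx : x ∈ F.alg O) :
    (U : H →L[ℂ] H) * x * star (U : H →L[ℂ] H) ∈ F.alg O ∧
      star (U : H →L[ℂ] H) * x * (U : H →L[ℂ] H) ∈ F.alg O := by
  constructor
  · rw [h.conj_coe (A := ⟨x, mem_quasilocal hx⟩) (alg_mono hO hx), α.map_alg]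
    exact hx
  · set y := (α.toHom g).symm ⟨x, mem_quasilocal hx⟩ with hy
    have hgy : α.toHom g y = ⟨x, mem_quasilocal hx⟩ := (α.toHom g).apply_symm_apply _
    have hyO : (y : H →L[ℂ] H) ∈ F.alg O := by
      rw [← α.map_alg g, hgy]; exact hx
    have := h.conj_coe (alg_mono hO hyO)
    rw [hgy, conj_eq_iff_eq_conj (coe_mem_unitary h.unitary)] at this
    rwa [← this]

end IsLocalImplementer

/-- If `K` contains the outer double cone of `Λ`, there is a unitary whose action on `F(K)`
coincides with `α_g` to the left, and with the local implementer for `Λ` to the right, of the left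
tip of the right relative complement of `Λ`. -/
theorem exists_unitary_glueing (hd : F.HaagDuality) (hs : F.SplitProperty) (hf : F.LocalFactors)
    (hm : F.MinimalRelativeCommutants) {U : ConePair → G → F.quasilocal}
    (hU : F.IsImplementerFamily α U) (g : G) {Λ : ConePair} {K L R : DoubleCone}
    (hK : Λ.outer.Within K) (hcut : K.IsCut L R) (hRb : R.b = Λ.inner.a) (hRc : R.c = Λ.inner.d) :
    ∃ T ∈ F.quasilocal, T ∈ unitary (H →L[ℂ] H) ∧
      (∀ A : F.quasilocal, (A : H →L[ℂ] H) ∈ F.alg L → T * A * star T = α.toHom g A) ∧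
      ∀ x ∈ F.alg R, T * x * star T = U Λ g * x * star (U Λ g : H →L[ℂ] H) := by
  obtain ⟨hKa, hKb, hKc, hKd⟩ := hK
  have hΛa := Λ.ha
  have hΛb := Λ.hb
  have hΛc := Λ.hc
  have hΛd := Λ.hd
  have hIu := Λ.inner.hab
  have hIv := Λ.inner.hcd
  have hKu := K.hab
  have hKv := K.hcd
  -- Any enlargement of `K` would do; it only provides an implementer of α_g on all of F(K).
  let Kh : DoubleCone := ⟨K.a - 1, K.b + 1, K.c - 1, K.d + 1, by linarith, by linarith⟩
  let ΛK : ConePair := ⟨K, Kh, by simp [Kh], by simp [Kh], by simp [Kh], by simp [Kh]⟩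
  let ΛI : ConePair := ⟨Λ.inner, Kh, by dsimp [Kh]; linarith, by dsimp [Kh]; linarith,
    by dsimp [Kh]; linarith, by dsimp [Kh]; linarith⟩
  let LL : DoubleCone := ⟨Λ.outer.b, Kh.b, Kh.c, Λ.outer.c, by dsimp [Kh]; linarith,
    by dsimp [Kh]; linarith⟩
  let Q : DoubleCone := ⟨Λ.inner.b, K.b, K.c, Λ.inner.c, by linarith, by linarith⟩
  -- The outer cone ends in the middle of `Λ.inner`, so it is still spacelike to `ΛI.right`. The
  -- split property then separates the two components of the relative commutant.
  let ΛS : ConePair := ⟨ΛI.left,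
    ⟨(Λ.inner.a + Λ.inner.b) / 2, Kh.b + 1, Kh.c - 1, (Λ.inner.c + Λ.inner.d) / 2,
      by dsimp [Kh]; linarith, by dsimp [Kh]; linarith⟩,
    by dsimp [ΛI, ConePair.left]; linarith, by dsimp [ΛI, ConePair.left]; linarith,
    by dsimp [ΛI, ConePair.left]; linarith, by dsimp [ΛI, ConePair.left]; linarith⟩
  have hcutU : ΛI.left.IsCut LL Λ.left := ⟨rfl, rfl, rfl, rfl, rfl, rfl⟩
  have hcutV : ΛI.left.IsCut ΛK.left Q := ⟨rfl, rfl, rfl, rfl, rfl, rfl⟩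
  have hcutL : L.IsCut Q Λ.inner :=
    ⟨rfl, hcut.lb.symm, hcut.lc.symm, rfl, by rw [hcut.la, hRb], by rw [hcut.ld, hRc]⟩
  have hQK : Q.Within K := ⟨by dsimp [Q]; linarith, le_rfl, le_rfl, by dsimp [Q]; linarith⟩
  have hQN : Q.Within ΛI.left := hcutV.right_within
  have hIK : Λ.inner.Within K := ⟨by linarith, by linarith, by linarith, by linarith⟩
  have hOKh : Λ.outer.Within Kh := ⟨by dsimp [Kh]; linarith, by dsimp [Kh]; linarith,
    by dsimp [Kh]; linarith, by dsimp [Kh]; linarith⟩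
  have hNI : ΛI.left.LeftOf Λ.inner := ⟨le_rfl, le_rfl⟩
  have hNR : ΛI.left.LeftOf R := ⟨hRb.trans_le hIu.le, hIv.le.trans hRc.ge⟩
  have hΛU := hU Λ g
  have hΛV := hU ΛK g
  set u : H →L[ℂ] H := (U Λ g : H →L[ℂ] H) with hu
  set V : H →L[ℂ] H := (U ΛK g : H →L[ℂ] H) with hV
  have huu : u ∈ unitary (H →L[ℂ] H) := coe_mem_unitary hΛU.unitary
  have hVu : V ∈ unitary (H →L[ℂ] H) := coe_mem_unitary hΛV.unitary
  have huV : ∀ x ∈ F.alg Λ.inner, u * x * star u = V * x * star V := fun x hx => by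
    rw [hΛU.conj_coe (A := ⟨x, mem_quasilocal hx⟩) hx,
      hΛV.conj_coe (A := ⟨x, mem_quasilocal hx⟩) (alg_mono hIK hx)]
  -- Two cuts of `ΛI.left` are used. For `u` the parts are `Λ.left`, which it normalizes, and `LL`,
  -- with which it commutes. For `V` they are `ΛK.left`, which it normalizes, and `Q`, where it acts
  -- as α_g.
  have hu2 : ∀ x ∈ F.alg ΛI.left,
      u * x * star u ∈ F.alg ΛI.left ∧ star u * x * u ∈ F.alg ΛI.left := by
    refine fun x hx => conj_both_mem_of_isCut hs hf hm hcutU huu (fun y hy => ?_)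
      (fun y hy => conj_mem_of_image_eq huu hΛU.left hy) hx
    have hLO : LL.LeftOf Λ.outer := ⟨le_rfl, le_rfl⟩
    have hc : u * y = y * u := (hd.commute hLO hy hΛU.mem).symm
    rw [conj_eq_self huu hc, star_conj_eq_self huu hc]
    exact ⟨hy, hy⟩
  have hV2 : ∀ x ∈ F.alg ΛI.left,
      V * x * star V ∈ F.alg ΛI.left ∧ star V * x * V ∈ F.alg ΛI.left := fun x hx =>
    conj_both_mem_of_isCut hs hf hm hcutV hVu (fun y hy => conj_mem_of_image_eq hVu hΛV.left hy)
      (fun y hy => hΛV.conj_mem_of_within hQK hy) hx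
  have hW : star V * u ∈ Set.centralizer (Set.centralizer
      ((F.alg ΛI.left : Set (H →L[ℂ] H)) ∪ F.alg ΛI.right)) := by
    rw [Set.union_comm, ← hm ΛI]
    refine ⟨mul_mem (star_mem hΛV.mem) (alg_mono hOKh hΛU.mem), fun x hx => ?_⟩
    rw [← mul_conj_eq_iff huu hVu]
    exact huV x hx
  obtain ⟨M, hM, hM1, hM2⟩ := hs ΛS
  have hP : F.alg ΛI.right ≤ M.commutant := fun p hp => VonNeumannAlgebra.mem_commutant_iff.2
    fun m hm' => hd.commute (L := ΛS.outer)
      ⟨by dsimp [ΛS, ΛI, ConePair.right]; linarith, by dsimp [ΛS, ΛI, ConePair.right]; linarith⟩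
      (hM2 hm') hp
  obtain ⟨w, hwu, hwN, hw⟩ := exists_unitary_implementing hM (hf ΛI.left) hM1 hP hW
    (mul_mem (Unitary.star_mem hVu) huu)
    (fun x hx => by
      have := (hV2 _ (hu2 x hx).1).2
      simpa only [star_mul, star_star, mul_assoc] using this)
    (fun x hx => by
      have := (hu2 _ (hV2 x hx).1).2
      simpa only [star_mul, star_star, mul_assoc] using this)
  -- The factor `star w` changes the action of `u` on F(ΛI.left) into that of `V`, and has no effect
  -- on `Λ.inner` and `R`, which are spacelike to `ΛI.left`.
  have hTu : u * star w ∈ unitary (H →L[ℂ] H) := mul_mem huu (Unitary.star_mem hwu)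
  have hTconj : ∀ x, (u * star w) * x * star (u * star w) = u * (star w * x * w) * star u :=
    fun x => by simp only [star_mul, star_star, mul_assoc]
  have hTV : ∀ x ∈ F.alg L, (u * star w) * x * star (u * star w) = V * x * star V := by
    refine fun x hx => conj_eq_conj_of_isCut hs hf hm hcutL hTu hVu (fun x hx => ?_)
      (fun x hx => ?_) hx
    · have hxN := alg_mono hQN hx
      have h1 := hw _ (mul_mem (mul_mem (star_mem hwN) hxN) hwN)
      rw [(conj_eq_iff_eq_conj hwu).2 rfl] at h1
      rw [hTconj, eq_comm, conj_eq_iff_eq_conj hVu]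
      refine h1.trans ?_
      simp only [star_mul, star_star, mul_assoc]
    · rw [hTconj, star_conj_eq_self hwu (hd.commute hNI hwN hx), huV x hx]
  have hTR : ∀ x ∈ F.alg R, (u * star w) * x * star (u * star w) = u * x * star u :=
    fun x hx => by rw [hTconj, star_conj_eq_self hwu (hd.commute hNR hwN hx)]
  have hTα : ∀ A : F.quasilocal, (A : H →L[ℂ] H) ∈ F.alg L →
      (u * star w) * A * star (u * star w) = α.toHom g A := fun A hA => by
    rw [hTV A hA, hΛV.conj_coe (alg_mono hcut.left_within hA)]
  exact ⟨u * star w, mul_mem (U Λ g).2 (star_mem (mem_quasilocal hwN)), hTu, hTα, hTR⟩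

end LocalNet

/-! ### Soliton automorphisms from local implementers -/

namespace DoubleCone

/-- A pair of double cones whose right relative complement is `D`. -/
noncomputable def pair (D : DoubleCone) : ConePair where
  inner := ⟨D.b, D.b + 1, D.c - 1, D.c, by linarith, by linarith⟩
  outer := ⟨D.a, D.b + 2, D.c - 2, D.d, by linarith [D.hab], by linarith [D.hcd]⟩
  ha := D.hab
  hb := by dsimp only; linarith
  hc := by dsimp only; linarith
  hd := D.hcd

/-- An increasing sequence of double cones exhausting Minkowski space. -/
noncomputable def hull (D : DoubleCone) (n : ℕ) : DoubleCone where
  -- At n = 0 the offset 1 keeps `hullFarRight` nonempty, and the offset 2 on the left makes room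
  -- for `D.pair.outer`.
  a := D.a - (n + 1)
  b := D.b + (n + 2)
  c := D.c - (n + 2)
  d := D.d + (n + 1)
  hab := by linarith [D.hab, n.cast_nonneg (α := ℝ)]
  hcd := by linarith [D.hcd, n.cast_nonneg (α := ℝ)]

/-- The part of `D.hull n` to the left of the left tip of `D`. -/
noncomputable def hullLeft (D : DoubleCone) (n : ℕ) : DoubleCone where
  a := D.b
  b := D.b + (n + 2)
  c := D.c - (n + 2)
  d := D.c
  hab := by linarith [n.cast_nonneg (α := ℝ)]
  hcd := by linarith [n.cast_nonneg (α := ℝ)]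

/-- The part of `D.hull n` to the right of the left tip of `D`. -/
noncomputable def hullRight (D : DoubleCone) (n : ℕ) : DoubleCone where
  a := D.a - (n + 1)
  b := D.b
  c := D.c
  d := D.d + (n + 1)
  hab := by linarith [D.hab, n.cast_nonneg (α := ℝ)]
  hcd := by linarith [D.hcd, n.cast_nonneg (α := ℝ)]

/-- The part of `D.hull n` to the right of the right tip of `D`. -/
noncomputable def hullFarRight (D : DoubleCone) (n : ℕ) : DoubleCone where
  a := D.a - (n + 1)
  b := D.a
  c := D.d
  d := D.d + (n + 1)
  hab := by linarith [n.cast_nonneg (α := ℝ)]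
  hcd := by linarith [n.cast_nonneg (α := ℝ)]

variable (D : DoubleCone) (n : ℕ)

theorem isCut_hull : (D.hull n).IsCut (D.hullLeft n) (D.hullRight n) :=
  ⟨rfl, rfl, rfl, rfl, rfl, rfl⟩

theorem isCut_hullRight : (D.hullRight n).IsCut D (D.hullFarRight n) :=
  ⟨rfl, rfl, rfl, rfl, rfl, rfl⟩

theorem pair_outer_within_hull : D.pair.outer.Within (D.hull n) := by
  have := n.cast_nonneg (α := ℝ)
  constructor <;> dsimp [pair, hull] <;> linarith

theorem hull_mono {m n : ℕ} (h : m ≤ n) : (D.hull m).Within (D.hull n) := by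
  have : (m : ℝ) ≤ n := by exact_mod_cast h
  constructor <;> dsimp [hull] <;> linarith

theorem hullLeft_mono {m n : ℕ} (h : m ≤ n) : (D.hullLeft m).Within (D.hullLeft n) := by
  have : (m : ℝ) ≤ n := by exact_mod_cast h
  constructor <;> dsimp [hullLeft] <;> linarith

theorem hullRight_mono {m n : ℕ} (h : m ≤ n) : (D.hullRight m).Within (D.hullRight n) := by
  have : (m : ℝ) ≤ n := by exact_mod_cast h
  constructor <;> dsimp [hullRight] <;> linarith

theorem exists_within_hull (O : DoubleCone) : ∃ n, O.Within (D.hull n) := by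
  obtain ⟨n, hn⟩ := exists_nat_ge (max (max (D.a - O.a) (O.b - D.b)) (max (D.c - O.c) (O.d - D.d)))
  simp only [max_le_iff] at hn
  obtain ⟨⟨h1, h2⟩, h3, h4⟩ := hn
  refine ⟨n, ?_⟩
  constructor <;> dsimp [hull] <;> linarith

end DoubleCone

/-! ### Existence, uniqueness and algebraic relations of the glued automorphisms -/

namespace LocalNet

variable {H : Type u} [NormedAddCommGroup H] [InnerProductSpace ℂ H] [CompleteSpace H]
  {F : LocalNet H} {G : Type v} [Group G] {α : F.Symmetry G}

/-- The automorphism `ρ` acts on `F(O)` by conjugation with a unitary operator. -/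
def ImplementedOn (F : LocalNet H) (O : DoubleCone) (ρ : F.Aut) : Prop :=
  ∃ T ∈ unitary (H →L[ℂ] H), ∀ A : F.quasilocal, (A : H →L[ℂ] H) ∈ F.alg O →
    (ρ A : H →L[ℂ] H) = T * A * star T

theorem ImplementedOn.mul {O : DoubleCone} {ρ σ : F.Aut} (hρ : F.ImplementedOn O ρ)
    (hσ : F.ImplementedOn O σ)
    (h : ∀ A : F.quasilocal, (A : H →L[ℂ] H) ∈ F.alg O → (σ A : H →L[ℂ] H) ∈ F.alg O) :
    F.ImplementedOn O (ρ * σ) := by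
  obtain ⟨S, hS, hρ⟩ := hρ
  obtain ⟨T, hT, hσ⟩ := hσ
  refine ⟨S * T, mul_mem hS hT, fun A hA => ?_⟩
  change (ρ (σ A) : H →L[ℂ] H) = _
  rw [hρ _ (h A hA), hσ A hA]
  simp only [star_mul, mul_assoc]

theorem IsImplementerFamily.implementedOn {U : ConePair → G → F.quasilocal}
    (hU : F.IsImplementerFamily α U) (g : G) (O : DoubleCone) :
    F.ImplementedOn O (α.toHom g) := by
  let Λ : ConePair := ⟨O, ⟨O.a - 1, O.b + 1, O.c - 1, O.d + 1, by linarith [O.hab],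
    by linarith [O.hcd]⟩, by simp, by simp, by simp, by simp⟩
  exact ⟨U Λ g, coe_mem_unitary (hU Λ g).unitary, fun A hA => ((hU Λ g).conj_coe hA).symm⟩

theorem locallyNormal_of_implementedOn {ρ : F.Aut}
    (h : ∀ O : DoubleCone, F.ImplementedOn O ρ) : F.LocallyNormal ρ := by
  intro O x y hx hy
  obtain ⟨T, hT, hρ⟩ := h O
  have hnorm : ∀ v, ‖star T v‖ = ‖v‖ := fun v =>
    ContinuousLinearMap.norm_map_of_mem_unitary (Unitary.star_mem hT) v
  refine ⟨fun n => star T (x n), fun n => star T (y n), by simpa only [hnorm] using hx,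
    by simpa only [hnorm] using hy, fun A hA => tsum_congr fun n => ?_⟩
  rw [hρ A hA, ContinuousLinearMap.star_eq_adjoint, ContinuousLinearMap.adjoint_inner_left]
  rfl

/-- The two parts of a hull generate its algebra only as a von Neumann algebra, so agreement on the
parts does not suffice for arbitrary automorphisms. Unitary implementation on each hull closes this
gap. -/
theorem aut_eq_of_hull (hs : F.SplitProperty) (hf : F.LocalFactors)
    (hm : F.MinimalRelativeCommutants) (D : DoubleCone) {ρ σ : F.Aut}
    (hρ : ∀ n, F.ImplementedOn (D.hull n) ρ) (hσ : ∀ n, F.ImplementedOn (D.hull n) σ)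
    (hL : ∀ n, ∀ A : F.quasilocal, (A : H →L[ℂ] H) ∈ F.alg (D.hullLeft n) → ρ A = σ A)
    (hR : ∀ n, ∀ A : F.quasilocal, (A : H →L[ℂ] H) ∈ F.alg (D.hullRight n) → ρ A = σ A) :
    ρ = σ := by
  refine aut_ext fun O A hA => Subtype.ext ?_
  obtain ⟨n, hn⟩ := D.exists_within_hull O
  obtain ⟨S, hS, hρS⟩ := hρ n
  obtain ⟨T, hT, hσT⟩ := hσ n
  have hcut := D.isCut_hull n
  have hAn := alg_mono hn hA
  rw [hρS A hAn, hσT A hAn]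
  refine conj_eq_conj_of_isCut hs hf hm hcut hS hT (fun x hx => ?_) (fun x hx => ?_) hAn
  · have := congrArg Subtype.val (hL n ⟨x, mem_quasilocal hx⟩ hx)
    rwa [hρS _ (alg_mono hcut.left_within hx), hσT _ (alg_mono hcut.left_within hx)] at this
  · have := congrArg Subtype.val (hR n ⟨x, mem_quasilocal hx⟩ hx)
    rwa [hρS _ (alg_mono hcut.right_within hx), hσT _ (alg_mono hcut.right_within hx)] at this

/-- The automorphism `ρ` acts as `α_g` to the left, and as conjugation with `U` to the right, of
the left tip of `D`. -/
structure IsGlued (F : LocalNet H) (α : F.Symmetry G) (g : G) (D : DoubleCone)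
    (U : F.quasilocal) (ρ : F.Aut) : Prop where
  implementedOn : ∀ n, F.ImplementedOn (D.hull n) ρ
  map_mem : ∀ n, ∀ A : F.quasilocal, (A : H →L[ℂ] H) ∈ F.alg (D.hull n) →
    (ρ A : H →L[ℂ] H) ∈ F.alg (D.hull n)
  left : ∀ n, ∀ A : F.quasilocal, (A : H →L[ℂ] H) ∈ F.alg (D.hullLeft n) → ρ A = α.toHom g A
  right : ∀ n, ∀ A : F.quasilocal, (A : H →L[ℂ] H) ∈ F.alg (D.hullRight n) →
    ρ A = U * A * star U

/-- Cut at the right tip of `D`: the implementer normalizes F(D), as `D` is the right relative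
complement of `D.pair`, and commutes with the far right part. -/
theorem IsLocalImplementer.conj_mem_hullRight (hd : F.HaagDuality) (hs : F.SplitProperty)
    (hf : F.LocalFactors) (hm : F.MinimalRelativeCommutants) {g : G} {D : DoubleCone}
    {U : F.quasilocal} (hU : F.IsLocalImplementer α g D.pair U) (n : ℕ) {x : H →L[ℂ] H}
    (hx : x ∈ F.alg (D.hullRight n)) :
    (U : H →L[ℂ] H) * x * star (U : H →L[ℂ] H) ∈ F.alg (D.hullRight n) ∧
      star (U : H →L[ℂ] H) * x * (U : H →L[ℂ] H) ∈ F.alg (D.hullRight n) := by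
  have hu := coe_mem_unitary hU.unitary
  refine conj_both_mem_of_isCut hs hf hm (D.isCut_hullRight n) hu
    (fun y hy => conj_mem_of_image_eq hu hU.right hy) (fun y hy => ?_) hx
  have hc := hd.commute (L := D.pair.outer) (R := D.hullFarRight n) ⟨le_rfl, le_rfl⟩ hU.mem hy
  rw [conj_eq_self hu hc, star_conj_eq_self hu hc]
  exact ⟨hy, hy⟩

theorem IsImplementerFamily.exists_isGlued (hd : F.HaagDuality) (hs : F.SplitProperty)
    (hf : F.LocalFactors) (hm : F.MinimalRelativeCommutants) {U : ConePair → G → F.quasilocal}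
    (hU : F.IsImplementerFamily α U) (g : G) (D : DoubleCone) :
    ∃ ρ : F.Aut, F.IsGlued α g D (U D.pair g) ρ := by
  have hex := fun n => exists_unitary_glueing hd hs hf hm hU g (D.pair_outer_within_hull n)
    (D.isCut_hull n) rfl rfl
  choose T hTq hTu hTL hTR using hex
  -- The unitaries `T n` were chosen independently, but their actions are prescribed on both parts
  -- of the cut and therefore agree.
  have hcomp : ∀ m n, m ≤ n → ∀ x ∈ F.alg (D.hull m),
      T n * x * star (T n) = T m * x * star (T m) := by
    refine fun m n hmn x hx => conj_eq_conj_of_isCut hs hf hm (D.isCut_hull m) (hTu n) (hTu m)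
      (fun y hy => ?_) (fun y hy => ?_) hx
    · rw [hTL m ⟨y, mem_quasilocal hy⟩ hy,
        hTL n ⟨y, mem_quasilocal hy⟩ (alg_mono (D.hullLeft_mono hmn) hy)]
    · rw [hTR m y hy, hTR n y (alg_mono (D.hullRight_mono hmn) hy)]
  have hmem : ∀ n, ∀ x ∈ F.alg (D.hull n), T n * x * star (T n) ∈ F.alg (D.hull n) ∧
      star (T n) * x * T n ∈ F.alg (D.hull n) := by
    refine fun n x hx => conj_both_mem_of_isCut hs hf hm (D.isCut_hull n) (hTu n)
      (fun y hy => ⟨?_, ?_⟩) (fun y hy => ⟨?_, ?_⟩) hx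
    · rw [hTL n ⟨y, mem_quasilocal hy⟩ hy, α.map_alg]
      exact hy
    · set z := (α.toHom g).symm ⟨y, mem_quasilocal hy⟩ with hz
      have hgz : α.toHom g z = ⟨y, mem_quasilocal hy⟩ := (α.toHom g).apply_symm_apply _
      have hzO : (z : H →L[ℂ] H) ∈ F.alg (D.hullLeft n) := by
        rw [← α.map_alg g, hgz]; exact hy
      have := hTL n z hzO
      rw [hgz, conj_eq_iff_eq_conj (hTu n)] at this
      rwa [← this]
    · rw [hTR n y hy]
      exact ((hU D.pair g).conj_mem_hullRight hd hs hf hm n hy).1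
    · have h1 := ((hU D.pair g).conj_mem_hullRight hd hs hf hm n hy).2
      have h2 := hTR n _ h1
      rw [(conj_eq_iff_eq_conj (coe_mem_unitary (hU D.pair g).unitary)).2 rfl,
        conj_eq_iff_eq_conj (hTu n)] at h2
      rwa [← h2]
  obtain ⟨ρ, hρ⟩ := exists_starAlgEquiv_eq_unitary_conj
    (dense_iUnion_alg (F := F) (K := D.hull) (fun _ _ => D.hull_mono) D.exists_within_hull)
    (T := fun n => ⟨T n, hTq n⟩) (fun n => mem_unitary_of_coe (hTu n))
    (fun m n hmn A hA => Subtype.ext (hcomp m n hmn A hA))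
    (fun n A hA => (hmem n A hA).1) (fun n A hA => (hmem n A hA).2)
  have hρ' : ∀ n, ∀ A : F.quasilocal, (A : H →L[ℂ] H) ∈ F.alg (D.hull n) →
      (ρ A : H →L[ℂ] H) = T n * A * star (T n) := fun n A hA => congrArg Subtype.val (hρ n A hA)
  refine ⟨ρ, fun n => ⟨T n, hTu n, hρ' n⟩, fun n A hA => ?_, fun n A hA => ?_, fun n A hA => ?_⟩
  · rw [hρ' n A hA]
    exact (hmem n A hA).1
  · exact Subtype.ext ((hρ' n A (alg_mono (D.isCut_hull n).left_within hA)).trans (hTL n A hA))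
  · exact Subtype.ext ((hρ' n A (alg_mono (D.isCut_hull n).right_within hA)).trans (hTR n A hA))

theorem IsGlued.locallyNormal {g : G} {D : DoubleCone} {U : F.quasilocal} {ρ : F.Aut}
    (h : F.IsGlued α g D U ρ) : F.LocallyNormal ρ := by
  refine locallyNormal_of_implementedOn fun O => ?_
  obtain ⟨n, hn⟩ := D.exists_within_hull O
  obtain ⟨T, hT, hρ⟩ := h.implementedOn n
  exact ⟨T, hT, fun A hA => hρ A (alg_mono hn hA)⟩

/-- `D` and `D.pair.outer` share their right tip, so to the right of `D` the conjugation with `U` is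
trivial by locality. -/
theorem IsGlued.isSoliton (hd : F.HaagDuality) {g : G} {D : DoubleCone} {U : F.quasilocal}
    {ρ : F.Aut} (h : F.IsGlued α g D U ρ) (hU : F.IsLocalImplementer α g D.pair U) :
    F.IsSoliton α g D ρ := by
  constructor
  · refine eqOn_region (f := (ρ : F.quasilocal →⋆ₐ[ℂ] F.quasilocal))
      (g := (α.toHom g : F.quasilocal →⋆ₐ[ℂ] F.quasilocal)) fun O hO A hA => ?_
    have hLO := DoubleCone.leftOf_of_subset_left hO
    obtain ⟨n, hn⟩ := D.exists_within_hull O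
    exact h.left n A (alg_mono (O₂ := D.hullLeft n) ⟨hLO.u, hn.b, hn.c, hLO.v⟩ hA)
  · refine eqOn_region (f := (ρ : F.quasilocal →⋆ₐ[ℂ] F.quasilocal))
      (g := .id ℂ F.quasilocal) fun O hO A hA => ?_
    have hLO := DoubleCone.leftOf_of_subset_right hO
    obtain ⟨n, hn⟩ := D.exists_within_hull O
    refine (h.right n A (alg_mono (O₂ := D.hullRight n)
      ⟨hn.a, hLO.u.trans D.hab.le, D.hcd.le.trans hLO.v, hn.d⟩ hA)).trans (Subtype.ext ?_)
    exact conj_eq_self (coe_mem_unitary hU.unitary)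
      (hd.commute (L := D.pair.outer) ⟨hLO.u, hLO.v⟩ hU.mem hA)

theorem IsGlued.conj_eq (hs : F.SplitProperty) (hf : F.LocalFactors)
    (hm : F.MinimalRelativeCommutants) {U : ConePair → G → F.quasilocal}
    (hU : F.IsImplementerFamily α U) (hc : F.CovariantImplementers α U) {g k : G}
    {D : DoubleCone} {ρ σ : F.Aut} (hρ : F.IsGlued α g D (U D.pair g) ρ)
    (hσ : F.IsGlued α (k * g * k⁻¹) D (U D.pair (k * g * k⁻¹)) σ) :
    α.toHom k * ρ = σ * α.toHom k := by
  refine aut_eq_of_hull hs hf hm D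
    (fun n => (hU.implementedOn k _).mul (hρ.implementedOn n) (hρ.map_mem n))
    (fun n => (hσ.implementedOn n).mul (hU.implementedOn k _)
      fun A hA => (α.map_alg k _ A).2 hA) (fun n A hA => ?_) (fun n A hA => ?_)
  · change α.toHom k (ρ A) = σ (α.toHom k A)
    rw [hρ.left n A hA, hσ.left n _ ((α.map_alg k _ A).2 hA)]
    change (α.toHom k * α.toHom g) A = (α.toHom (k * g * k⁻¹) * α.toHom k) A
    rw [← map_mul, ← map_mul, inv_mul_cancel_right]
  · change α.toHom k (ρ A) = σ (α.toHom k A)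
    rw [hρ.right n A hA, hσ.right n _ ((α.map_alg k _ A).2 hA), map_mul, map_mul, map_star,
      hc]

theorem IsGlued.mul_eq (hd : F.HaagDuality) (hs : F.SplitProperty) (hf : F.LocalFactors)
    (hm : F.MinimalRelativeCommutants) {U : ConePair → G → F.quasilocal}
    (hU : F.IsImplementerFamily α U) (hc : F.MultiplicativeImplementers U) {g h : G}
    {D : DoubleCone} {ρ σ τ : F.Aut} (hρ : F.IsGlued α g D (U D.pair g) ρ)
    (hσ : F.IsGlued α h D (U D.pair h) σ) (hτ : F.IsGlued α (g * h) D (U D.pair (g * h)) τ) :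
    τ = ρ * σ := by
  refine aut_eq_of_hull hs hf hm D hτ.implementedOn
    (fun n => (hρ.implementedOn n).mul (hσ.implementedOn n) (hσ.map_mem n))
    (fun n A hA => ?_) (fun n A hA => ?_)
  · change τ A = ρ (σ A)
    rw [hτ.left n A hA, hσ.left n A hA, hρ.left n _ ((α.map_alg h _ A).2 hA), map_mul]
    rfl
  · change τ A = ρ (σ A)
    rw [hτ.right n A hA, hσ.right n A hA,
      hρ.right n _ ((hU D.pair h).conj_mem_hullRight hd hs hf hm n hA).1, ← hc]
    simp only [star_mul, mul_assoc]

end LocalNet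

end SolitonQFT

theorem mainTheorem6 {H : Type*} [NormedAddCommGroup H] [InnerProductSpace ℂ H]
    [CompleteSpace H] (F : SolitonQFT.LocalNet H) {G : Type*} [Group G] (α : F.Symmetry G)
    (hduality : F.HaagDuality) (hsplit : F.SplitProperty) (hfactor : F.LocalFactors)
    (hminimal : F.MinimalRelativeCommutants) :
    ((∃ U : SolitonQFT.ConePair → G → F.quasilocal,
        F.IsImplementerFamily α U ∧ F.CovariantImplementers α U) →
      ∃ ρ : SolitonQFT.DoubleCone → G → F.Aut,
        F.IsSolitonFamily α ρ ∧ F.PropertyA α ρ) ∧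
    ((∃ U : SolitonQFT.ConePair → G → F.quasilocal,
        F.IsImplementerFamily α U ∧ F.MultiplicativeImplementers U) →
      ∃ ρ : SolitonQFT.DoubleCone → G → F.Aut,
        F.IsSolitonFamily α ρ ∧ F.PropertyB ρ) ∧
    ((∃ U : SolitonQFT.ConePair → G → F.quasilocal,
        F.IsImplementerFamily α U ∧ F.CovariantImplementers α U ∧
          F.MultiplicativeImplementers U) →
      ∃ ρ : SolitonQFT.DoubleCone → G → F.Aut,
        F.IsSolitonFamily α ρ ∧ F.PropertyA α ρ ∧ F.PropertyB ρ) := by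
  -- A single ρ is built from `U` before either extra condition is used, so that (iii) obtains both
  -- properties for the same family.
  have key : ∀ U : SolitonQFT.ConePair → G → F.quasilocal, F.IsImplementerFamily α U →
      ∃ ρ : SolitonQFT.DoubleCone → G → F.Aut, F.IsSolitonFamily α ρ ∧
        (F.CovariantImplementers α U → F.PropertyA α ρ) ∧
        (F.MultiplicativeImplementers U → F.PropertyB ρ) := by
    intro U hU
    choose ρ hρ using fun D g => hU.exists_isGlued hduality hsplit hfactor hminimal g D
    exact ⟨ρ, fun D g => ⟨(hρ D g).isSoliton hduality (hU D.pair g), (hρ D g).locallyNormal⟩,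
      fun hc D k g => (hρ D g).conj_eq hsplit hfactor hminimal hU hc (hρ D _),
      fun hc D g h => (hρ D g).mul_eq hduality hsplit hfactor hminimal hU hc (hρ D h) (hρ D _)⟩
  refine ⟨?_, ?_, ?_⟩
  · rintro ⟨U, hU, hc⟩
    obtain ⟨ρ, h1, h2, -⟩ := key U hU
    exact ⟨ρ, h1, h2 hc⟩
  · rintro ⟨U, hU, hc⟩
    obtain ⟨ρ, h1, -, h2⟩ := key U hU
    exact ⟨ρ, h1, h2 hc⟩
  · rintro ⟨U, hU, hc, hc'⟩
    obtain ⟨ρ, h1, h2, h3⟩ := key U hU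
    exact ⟨ρ, h1, h2 hc, h3 hc'⟩
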